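/- Let $T>0$ and $x_0\in\mathbb R$, and let $S_0,\sigma:\mathbb R\to\mathbb R$ satisfy, for some constant $L$, $|S_0(x)-S_0(y)|+|\sigma(x)-\sigma(y)|\le L|x-y|$ for all $x,y\in\mathbb R$. Suppose that $\sigma(x)^2>0$ for all $x\in\mathbb R$. For every $\varepsilon>0$ let $X^\varepsilon=\{X_t,\ 0\le t\le T\}$ be, under the basic hypothesis $\mathcal H_0$, a solution of $$dX_t=S_0(X_t)\,dt+\varepsilon\,\sigma(X_t)\,dW_t,\qquad X_0=x_0,\quad 0\le t\le T,$$ where $W$ is a standard Wiener process with respect to a filtration to which $X$ is adapted (the filtered probability space may depend on $\varepsilon$), and let $\mathbf E_0$ denote expectation under $\mathcal H_0$. Let $\{\varphi_j,\ j\in\mathbb Z\}$ be an orthonormal basis of $L^2(0,T)$, and let $$y_{j,\varepsilon}=\int_0^T\frac{\varphi_j(t)}{\varepsilon\,\sigma(X_t)}\,\bigl[dX_t-S_0(X_t)\,dt\bigr],\qquad j\in\mathbb Z,$$ be the Fourier coefficients (stochastic integrals). For $m\in\mathbb N$ put $$\delta^*_\varepsilon=\frac1{\sqrt{4m}}\sum_{|j|<m}\bigl(y_{j,\varepsilon}^2-1\bigr).$$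 Then, under $\mathcal H_0$, all the stochastic integrals $y_{j,\varepsilon}$ exist and, for every $\varepsilon>0$, the random variables $y_{j,\varepsilon}$, $j\in\mathbb Z$, are independent with law $\mathcal N(0,1)$. Moreover, for every $\alpha\in(0,1)$ and every $m=m(\varepsilon)\in\mathbb N$ with $m(\varepsilon)\to\infty$ as $\varepsilon\to0^+$, the test $\psi^*_\varepsilon=\mathbf 1_{\{\delta^*_\varepsilon>z_\alpha\}}$, where $z_\alpha$ is the $(1-\alpha)$-quantile of $\mathcal N(0,1)$, has asymptotic size $\alpha$: $$\mathbf E_0\,\psi^*_\varepsilon\longrightarrow\alpha\qquad(\varepsilon\to0^+).$$ -/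

import Mathlib

open MeasureTheory ProbabilityTheory Filter Topology
open scoped NNReal ENNReal

namespace ChiSquareGoF

variable {Ω : Type*} {mΩ : MeasurableSpace Ω}

/-- A standard Wiener process with respect to the filtration `𝓕`: a Brownian motion which is
adapted to `𝓕` and whose increments `W t - W s`, `s ≤ t`, are independent of `𝓕 s`. -/
structure IsWienerProcess (𝓕 : Filtration ℝ≥0 mΩ) (P : Measure Ω) (W : ℝ≥0 → Ω → ℝ) : Prop where
  brownian : IsBrownianReal W P
  adapted : StronglyAdapted 𝓕 W
  indep : ∀ s t : ℝ≥0, s ≤ t →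
    Indep (MeasurableSpace.comap (fun ω => W t ω - W s ω) (borel ℝ)) (𝓕 s) P

/-- A simple predictable process `∑ i < n, coef i * 1_(time i, time (i + 1)]` with bounded
coefficients, `coef i` being `𝓕 (time i)`-measurable. -/
structure SimpleProcess (𝓕 : Filtration ℝ≥0 mΩ) where
  n : ℕ
  time : ℕ → ℝ≥0
  time_mono : Monotone time
  coef : ℕ → Ω → ℝ
  coef_measurable : ∀ i, Measurable[𝓕 (time i)] (coef i)
  coef_bounded : ∃ C : ℝ, ∀ i ω, |coef i ω| ≤ C

/-- The value at time `t` of a simple process. -/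
noncomputable def SimpleProcess.value {𝓕 : Filtration ℝ≥0 mΩ} (K : SimpleProcess 𝓕)
    (t : ℝ≥0) (ω : Ω) : ℝ :=
  ∑ i ∈ Finset.range K.n,
    (Set.Ioc (K.time i) (K.time (i + 1))).indicator (fun _ => K.coef i ω) t

/-- The elementary integral `∫_0^T K dZ` of a simple process `K`. -/
noncomputable def SimpleProcess.integral {𝓕 : Filtration ℝ≥0 mΩ} (K : SimpleProcess 𝓕)
    (Z : ℝ≥0 → Ω → ℝ) (T : ℝ≥0) (ω : Ω) : ℝ :=
  ∑ i ∈ Finset.range K.n,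
    K.coef i ω * (Z (min (K.time (i + 1)) T) ω - Z (min (K.time i) T) ω)

/-- `I` is (a version of) the stochastic integral `∫_0^T H dZ`, for a continuous local martingale
`Z` whose quadratic variation is `d⟨Z⟩_t = a_t dt`. The integrand `H` is progressively measurable
with `∫_0^T H_t² a_t dt < ∞` almost surely, and `I` is the limit in probability of elementary
integrals `∫_0^T K_n dZ` of simple processes such that `∫_0^T (K_n - H)² a_t dt → 0` in
probability. (For a Wiener process `Z`, `a = 1`.) -/
structure IsStochIntegral (𝓕 : Filtration ℝ≥0 mΩ) (P : Measure Ω) (Z a : ℝ≥0 → Ω → ℝ)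
    (T : ℝ≥0) (H : ℝ≥0 → Ω → ℝ) (I : Ω → ℝ) : Prop where
  progressive : IsStronglyProgressive 𝓕 H
  square_integrable : ∀ᵐ ω ∂P,
    ∫⁻ t in Set.Ioc (0 : ℝ) T, ENNReal.ofReal (H t.toNNReal ω ^ 2 * a t.toNNReal ω) < ∞
  aemeasurable : AEMeasurable I P
  approx : ∃ K : ℕ → SimpleProcess 𝓕,
    (∀ δ : ℝ≥0∞, 0 < δ → Tendsto (fun n => P {ω | δ ≤ ∫⁻ t in Set.Ioc (0 : ℝ) T,
      ENNReal.ofReal (((K n).value t.toNNReal ω - H t.toNNReal ω) ^ 2 * a t.toNNReal ω)})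
      atTop (𝓝 0)) ∧
    TendstoInMeasure P (fun n => (K n).integral Z T) atTop I

/-- The process `X_t - ∫_0^t S(X_s) ds`, whose differential is `dX_t - S(X_t) dt`. -/
noncomputable def innovation (S : ℝ → ℝ) (X : ℝ≥0 → Ω → ℝ) (t : ℝ≥0) (ω : Ω) : ℝ :=
  X t ω - ∫ s in (0 : ℝ)..t, S (X s.toNNReal ω)

/-- `X` solves `dX_t = S(X_t) dt + ε σ(X_t) dW_t`, `X_0 = x₀`, on `[0, T]`. -/
structure IsDiffusion (𝓕 : Filtration ℝ≥0 mΩ) (P : Measure Ω) (W : ℝ≥0 → Ω → ℝ)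
    (S σ : ℝ → ℝ) (ε x₀ : ℝ) (T : ℝ≥0) (X : ℝ≥0 → Ω → ℝ) : Prop where
  progressive : IsStronglyProgressive 𝓕 X
  continuous : ∀ᵐ ω ∂P, Continuous fun t => X t ω
  initial : ∀ᵐ ω ∂P, X 0 ω = x₀
  equation : ∀ t ≤ T, IsStochIntegral 𝓕 P W (fun _ _ => 1) t (fun s ω => ε * σ (X s ω))
    (fun ω => innovation S X t ω - x₀)

/-- `Y` is (a version of) the Fourier coefficient
`∫_0^T φ(t) / (ε σ(X_t)) [dX_t - S₀(X_t) dt]`.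
The quadratic variation of the integrator has density `(ε σ(X_t))²`. -/
def IsFourierCoeff (𝓕 : Filtration ℝ≥0 mΩ) (P : Measure Ω) (S₀ σ : ℝ → ℝ) (ε : ℝ) (T : ℝ≥0)
    (X : ℝ≥0 → Ω → ℝ) (φ : ℝ → ℝ) (Y : Ω → ℝ) : Prop :=
  IsStochIntegral 𝓕 P (innovation S₀ X) (fun t ω => (ε * σ (X t ω)) ^ 2) T
    (fun t ω => φ t / (ε * σ (X t ω))) Y

/-- The statistic `(4 m)^(-1/2) ∑_{|j| < m} (y_j² - 1)`. -/
noncomputable def chiSquareStat (m : ℕ) (y : ℤ → Ω → ℝ) (ω : Ω) : ℝ :=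
  1 / √(4 * m) * ∑ j ∈ Finset.Ioo (-(m : ℤ)) m, (y j ω ^ 2 - 1)

/-- The test which rejects when the statistic exceeds the threshold `z`. -/
noncomputable def chiSquareTest (m : ℕ) (y : ℤ → Ω → ℝ) (z : ℝ) : Ω → ℝ :=
  {ω | z < chiSquareStat m y ω}.indicator 1

end ChiSquareGoF

/-! Under the basic hypothesis `dX - S₀(X) dt = ε σ(X) dW`, so dividing by `ε σ(X)`, which never
vanishes, leaves `y_j = ∫ φ_j dW`, a Wiener integral free of `ε`, `σ` and `X`. Wiener integrals of
an orthonormal family are independent `N(0,1)`. The statistic is then a normalized sum of `2m - 1`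
independent copies of `ξ² - 1`, centred with variance 2, and the central limit theorem gives the
size.

The work lies in `dM = v dW`, with `M` the innovation and `v = ε σ(X)`. `IsItoLimit` is a working
notion of `∫ H dW`: a limit in probability of simple integrals. The truncated Chebyshev bound
`SimpleProcess.measure_le_abs_integral` passes to such limits and yields continuity in the integrand
(`IsItoLimit.tendstoInMeasure`), hence uniqueness. `IsItoLimit.simple_mul` gives `∫ K dM = ∫ K v dW`
for simple `K`. If the `K_n` approximate `h / v` with weight `v²`, then `K_n v` approximates `h`
without weight, so `∫ K_n dM` tends to `∫ h dW`. This proves both that the coefficient exists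
(`exists_isFourierCoeff`, with `exists_simple_approx_div`) and that it equals the Wiener integral
almost surely (`IsFourierCoeff.ae_eq`).

Gaussianity comes from deterministic simple approximations, independence from characteristic
functions of linear combinations (`iIndepFun_wienerIntegral`), and the limit from
`tendsto_integral_chiSquareTest`. -/

namespace ChiSquareGoF

/-! ### Gaussian moments and the central limit theorem for the statistic -/

/-- The fourth moment of the standard Gaussian distribution. -/
lemma integral_pow_four_gaussianReal : ∫ x, x ^ 4 ∂gaussianReal 0 1 = 3 := by
  -- The moment is read off as the fourth derivative at 0 of the moment generating function `exp (t²
  -- / 2)`.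
  have hmgf : mgf id (gaussianReal 0 1) = fun t : ℝ => Real.exp (t ^ 2 / 2) := by
    rw [mgf_id_gaussianReal]
    funext t
    simp
  have h0 : (0 : ℝ) ∈ interior (integrableExpSet id (gaussianReal 0 1)) := by
    simp
  have hE : ∀ t : ℝ, HasDerivAt (fun t : ℝ => Real.exp (t ^ 2 / 2)) (Real.exp (t ^ 2 / 2) * t) t := by
    intro t
    have := ((hasDerivAt_pow 2 t).div_const 2).exp
    convert this using 1
    simp
  have h1 : deriv (fun t : ℝ => Real.exp (t ^ 2 / 2)) = fun t => Real.exp (t ^ 2 / 2) * t :=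
    funext fun t => (hE t).deriv
  have h2 : deriv (fun t : ℝ => Real.exp (t ^ 2 / 2) * t)
      = fun t => Real.exp (t ^ 2 / 2) * (t ^ 2 + 1) := by
    funext t
    refine ((hE t).mul (hasDerivAt_id t)).deriv.trans ?_
    simp only [id]
    ring
  have h3 : deriv (fun t : ℝ => Real.exp (t ^ 2 / 2) * (t ^ 2 + 1))
      = fun t => Real.exp (t ^ 2 / 2) * (t ^ 3 + 3 * t) := by
    funext t
    refine ((hE t).mul ((hasDerivAt_pow 2 t).add_const 1)).deriv.trans ?_
    norm_num
    ring
  have h4 : deriv (fun t : ℝ => Real.exp (t ^ 2 / 2) * (t ^ 3 + 3 * t))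
      = fun t => Real.exp (t ^ 2 / 2) * (t ^ 4 + 6 * t ^ 2 + 3) := by
    funext t
    refine ((hE t).mul ((hasDerivAt_pow 3 t).add ((hasDerivAt_id t).const_mul 3))).deriv.trans ?_
    norm_num
    ring
  have h := iteratedDeriv_mgf_zero h0 4
  rw [hmgf] at h
  simp only [iteratedDeriv_succ, iteratedDeriv_zero, h1, h2, h3, h4] at h
  norm_num at h
  exact h.symm

lemma integral_pow_two_gaussianReal : ∫ x, x ^ 2 ∂gaussianReal 0 1 = 1 := by
  have h := variance_id_gaussianReal (μ := 0) (v := 1)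
  rw [variance_of_integral_eq_zero (by fun_prop) (by simp)] at h
  simpa using h

lemma integral_sq_sub_one_gaussianReal : ∫ x, (x ^ 2 - 1) ∂gaussianReal 0 1 = 0 := by
  have h2 : Integrable (fun x : ℝ => x ^ 2) (gaussianReal 0 1) :=
    (memLp_id_gaussianReal 2).integrable_sq
  rw [integral_sub h2 (integrable_const _), integral_pow_two_gaussianReal]
  simp

lemma integral_sq_sub_one_sq_gaussianReal : ∫ x, (x ^ 2 - 1) ^ 2 ∂gaussianReal 0 1 = 2 := by
  have h2 : Integrable (fun x : ℝ => x ^ 2) (gaussianReal 0 1) :=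
    (memLp_id_gaussianReal 2).integrable_sq
  have h4 : Integrable (fun x : ℝ => x ^ 4) (gaussianReal 0 1) := by
    have := (memLp_id_gaussianReal (μ := 0) (v := 1) 4).integrable_norm_pow (p := 4) (by norm_num)
    simpa [Even.pow_abs (show Even 4 by decide)] using this
  have e : ∀ x : ℝ, (x ^ 2 - 1) ^ 2 = x ^ 4 - 2 * x ^ 2 + 1 := fun x => by ring
  simp_rw [e]
  have h42 : Integrable (fun x : ℝ => x ^ 4 - 2 * x ^ 2) (gaussianReal 0 1) :=
    h4.sub (h2.const_mul 2)
  rw [integral_add h42 (integrable_const _),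
    integral_sub h4 (h2.const_mul 2), integral_const_mul, integral_pow_two_gaussianReal,
    integral_pow_four_gaussianReal]
  norm_num

lemma charFun_map_sum_of_iid {ι Ω : Type*} {mΩ : MeasurableSpace Ω} {P : Measure Ω}
    [IsProbabilityMeasure P] {ν : Measure ℝ} {X : ι → Ω → ℝ} (hX : ∀ i, HasLaw (X i) ν P)
    (hind : iIndepFun X P) {f : ℝ → ℝ} (hf : Measurable f) (s : Finset ι) (t : ℝ) :
    charFun (P.map (fun ω => ∑ i ∈ s, f (X i ω))) t = charFun (ν.map f) t ^ s.card := by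
  have hm : ∀ i, AEMeasurable (fun ω => f (X i ω)) P := fun i =>
    hf.comp_aemeasurable (hX i).aemeasurable
  have hind2 : iIndepFun (fun i ω => f (X i ω)) P := hind.comp (fun _ => f) fun _ => hf
  rw [iIndepFun.charFun_map_fun_finsetSum_eq_prod (fun i _ => hm i) (hind2.restrict s),
    Finset.prod_apply]
  have : ∀ i ∈ s, charFun (P.map fun ω => f (X i ω)) t = charFun (ν.map f) t := by
    intro i _
    rw [← (hX i).map_eq, AEMeasurable.map_map_of_aemeasurable hf.aemeasurable (hX i).aemeasurable]
    rfl
  rw [Finset.prod_congr rfl this, Finset.prod_const]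

/-- The law of a sum of functions of independent identically distributed variables depends only
on the number of terms. -/
lemma map_sum_eq_of_iid {ι κ Ω Ω' : Type*} {mΩ : MeasurableSpace Ω} {mΩ' : MeasurableSpace Ω'}
    {P : Measure Ω} {P' : Measure Ω'} [IsProbabilityMeasure P] [IsProbabilityMeasure P']
    {ν : Measure ℝ} {X : ι → Ω → ℝ} {X' : κ → Ω' → ℝ} (hX : ∀ i, HasLaw (X i) ν P)
    (hX' : ∀ i, HasLaw (X' i) ν P') (hind : iIndepFun X P) (hind' : iIndepFun X' P')
    {f : ℝ → ℝ} (hf : Measurable f) (s : Finset ι) (s' : Finset κ) (hs : s.card = s'.card) :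
    P.map (fun ω => ∑ i ∈ s, f (X i ω)) = P'.map (fun ω => ∑ i ∈ s', f (X' i ω)) := by
  refine Measure.ext_of_charFun (funext fun t => ?_)
  rw [charFun_map_sum_of_iid hX hind hf, charFun_map_sum_of_iid hX' hind' hf, hs]

/-- Asymptotic size of the chi-square test for independent standard Gaussian observations. -/
lemma tendsto_integral_chiSquareTest {ι : Type*} {l : Filter ι} {Ω : ι → Type*}
    [∀ i, MeasurableSpace (Ω i)] {P : ∀ i, Measure (Ω i)} [∀ i, IsProbabilityMeasure (P i)]
    {y : ∀ i, ℤ → Ω i → ℝ}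
    (hy : ∀ᶠ i in l, (∀ j, HasLaw (y i j) (gaussianReal 0 1) (P i)) ∧ iIndepFun (y i) (P i))
    {α z : ℝ} (hz : cdf (gaussianReal 0 1) z = 1 - α) {m : ι → ℕ} (hm : Tendsto m l atTop) :
    Tendsto (fun i => ∫ ω, chiSquareTest (m i) (y i) z ω ∂(P i)) l (𝓝 α) := by
  -- The spaces vary with `i`, while the central limit theorem needs one sequence. An auxiliary
  -- i.i.d. sequence serves, since only the law of each finite sum matters.
  obtain ⟨Ω', _, P', X, hXm, hX, hXi, _⟩ := exists_iid ℕ (gaussianReal 0 1)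
  set U : ℕ → Ω' → ℝ := fun k ω => (X k ω ^ 2 - 1) / √2 with hU
  have hUi : iIndepFun U P' := hXi.comp (fun _ x => (x ^ 2 - 1) / √2) (by fun_prop)
  have hUid : ∀ k, IdentDistrib (U k) (U 0) P' P' := fun k =>
    (IdentDistrib.mk (hX k).aemeasurable (hX 0).aemeasurable
      ((hX k).map_eq.trans (hX 0).map_eq.symm)).comp (u := fun x => (x ^ 2 - 1) / √2)
      (by fun_prop)
  have hU0 : P'[U 0] = 0 := by
    simp only [hU, integral_div]
    have h := (hX 0).integral_comp (f := fun x => x ^ 2 - 1) (by fun_prop)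
    simp only [Function.comp_def] at h
    rw [h, integral_sq_sub_one_gaussianReal, zero_div]
  have hU2 : P'[U 0 ^ 2] = 1 := by
    simp only [hU, Pi.pow_apply, div_pow, integral_div]
    have h := (hX 0).integral_comp (f := fun x => (x ^ 2 - 1) ^ 2) (by fun_prop)
    simp only [Function.comp_def] at h
    rw [h, integral_sq_sub_one_sq_gaussianReal]
    norm_num
  have hclt := tendstoInDistribution_inv_sqrt_mul_sum (HasLaw.id (μ := gaussianReal 0 1))
    hU0 hU2 hUi hUid
  -- With `n = 2m - 1` terms, `√(n / (n + 1))` turns the CLT factor `1 / √(2n)` into `1 / √(4m)`; it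
  -- tends to 1 and is absorbed by Slutsky's lemma.
  have hc : Tendsto (fun n : ℕ => √((n : ℝ) / (n + 1))) atTop (𝓝 1) := by
    have := (tendsto_natCast_div_add_atTop (1 : ℝ)).sqrt
    simpa using this
  have hcm : TendstoInMeasure P' (fun (n : ℕ) (_ : Ω') => √((n : ℝ) / (n + 1))) atTop
      fun _ => (1 : ℝ) :=
    tendstoInMeasure_of_tendsto_ae (fun _ => aestronglyMeasurable_const) (ae_of_all _ fun _ => hc)
  have hsl := hclt.continuous_comp_prodMk_of_tendstoInMeasure_const
    (g := fun p : ℝ × ℝ => p.2 * p.1) (by fun_prop) hcm (fun _ => aemeasurable_const)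
  simp only [one_mul] at hsl
  -- The Gaussian law has no atom at `z`, so weak convergence gives convergence of the rejection
  -- probability.
  have hfr : (gaussianReal 0 1) (frontier (Set.Ioi z)) = 0 := by
    have := nullSingletonClass_gaussianReal (μ := 0) (v := 1) (by norm_num)
    rw [frontier_Ioi]
    exact measure_singleton z
  have hlim := ProbabilityMeasure.tendsto_measure_of_null_frontier_of_tendsto' hsl.tendsto
    (E := Set.Ioi z) (by simpa using hfr)
  simp only [ProbabilityMeasure.coe_mk] at hlim
  rw [show (Measure.map (fun ω : ℝ => id ω) (gaussianReal 0 1)) = gaussianReal 0 1 from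
    Measure.map_id] at hlim
  have hα : (gaussianReal 0 1).real (Set.Ioi z) = α := by
    rw [cdf_eq_real] at hz
    have := probReal_compl_eq_one_sub (μ := gaussianReal 0 1) (measurableSet_Iic (a := z))
    rw [Set.compl_Iic] at this
    rw [this, hz]
    ring
  have hlim' := (ENNReal.tendsto_toReal (measure_ne_top _ _)).comp hlim
  have hm' : Tendsto (fun i => 2 * m i - 1) l atTop :=
    tendsto_atTop_mono (fun i => by omega) hm
  have hfin := hlim'.comp hm'
  rw [show ((gaussianReal 0 1) (Set.Ioi z)).toReal = α from hα] at hfin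
  refine hfin.congr' ?_
  -- `m ≥ 1` keeps the truncated subtraction `2 * m - 1` honest and the square roots nonzero.
  filter_upwards [hy, hm.eventually_ge_atTop 1] with i hi hmi
  have hsum := map_sum_eq_of_iid hi.1 hX hi.2 hXi (f := fun x => x ^ 2 - 1) (by fun_prop)
    (Finset.Ioo (-(m i : ℤ)) (m i)) (Finset.range (2 * m i - 1)) (by simp; omega)
  have hym : AEMeasurable (fun ω => ∑ j ∈ Finset.Ioo (-(m i : ℤ)) (m i), (y i j ω ^ 2 - 1))
      (P i) := Finset.aemeasurable_fun_sum _ fun j _ =>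
    ((hi.1 j).aemeasurable.pow_const 2).sub_const 1
  have hXm' : Measurable fun ω => ∑ k ∈ Finset.range (2 * m i - 1), (X k ω ^ 2 - 1) :=
    Finset.measurable_fun_sum _ fun k _ => ((hXm k).pow_const 2).sub_const 1
  set A : Set ℝ := {x | z < 1 / √(4 * m i) * x} with hA
  have hAm : MeasurableSet A := measurableSet_lt measurable_const (measurable_const_mul _)
  have hset : {ω | z < chiSquareStat (m i) (y i) ω} =
      (fun ω => ∑ j ∈ Finset.Ioo (-(m i : ℤ)) (m i), (y i j ω ^ 2 - 1)) ⁻¹' A := rfl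
  have hnull : NullMeasurableSet {ω | z < chiSquareStat (m i) (y i) ω} (P i) := by
    rw [hset]; exact hym.nullMeasurableSet_preimage hAm
  have hleft : ∫ ω, chiSquareTest (m i) (y i) z ω ∂(P i)
      = (P i).real {ω | z < chiSquareStat (m i) (y i) ω} := by
    unfold chiSquareTest
    rw [integral_indicator₀ hnull]
    simp
  rw [hleft, hset, measureReal_def, ← Measure.map_apply_of_aemeasurable hym hAm, hsum,
    Measure.map_apply hXm' hAm, Function.comp_apply, Function.comp_apply,
    Measure.map_apply (by fun_prop) measurableSet_Ioi]
  congr 2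
  ext ω
  have hcalc : √(((2 * m i - 1 : ℕ) : ℝ) / ((2 * m i - 1 : ℕ) + 1)) *
      ((√((2 * m i - 1 : ℕ) : ℝ))⁻¹ * ∑ k ∈ Finset.range (2 * m i - 1), U k ω)
      = 1 / √(4 * m i) * ∑ k ∈ Finset.range (2 * m i - 1), (X k ω ^ 2 - 1) := by
    have hpos : (0 : ℝ) < ((2 * m i - 1 : ℕ) : ℝ) := by exact_mod_cast (by omega)
    have hcast : ((2 * m i - 1 : ℕ) : ℝ) + 1 = 2 * m i := by
      rw [Nat.cast_sub (by omega)]; push_cast; ring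
    have hmpos : (0 : ℝ) < m i := by exact_mod_cast hmi
    simp only [hU]
    rw [← Finset.sum_div, hcast, Real.sqrt_div hpos.le, show (4 * m i : ℝ) = (2 * m i) * 2 by ring,
      Real.sqrt_mul (by positivity) 2]
    have h1 := (Real.sqrt_pos.2 hpos).ne'
    have h2 := (Real.sqrt_pos.2 (show (0 : ℝ) < 2 * m i by positivity)).ne'
    field_simp
  simp only [Set.mem_preimage, Set.mem_Ioi, hA, Set.mem_ofPred_eq, hcalc]

/-! ### Algebra of simple processes -/

variable {Ω : Type*} {mΩ : MeasurableSpace Ω} {𝓕 : Filtration ℝ≥0 mΩ} {P : Measure Ω}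
  {W : ℝ≥0 → Ω → ℝ}

/-- A finite set of times is covered by a monotone sequence. -/
lemma exists_monotone_enumeration (S : Finset ℝ≥0) :
    ∃ (u : ℕ → ℝ≥0) (N : ℕ), Monotone u ∧ ∀ s ∈ S, ∃ p ≤ N, u p = s := by
  rcases S.eq_empty_or_nonempty with rfl | hS
  · exact ⟨fun _ => 0, 0, monotone_const, by simp⟩
  have hc : 0 < S.card := hS.card_pos
  -- Beyond the last element the sequence stays constant.
  refine ⟨fun i => S.orderEmbOfFin rfl ⟨min i (S.card - 1), by omega⟩, S.card, ?_, ?_⟩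
  · intro i j hij
    simp only [OrderEmbedding.le_iff_le, Fin.mk_le_mk]
    omega
  · intro s hs
    have : s ∈ Set.range (S.orderEmbOfFin rfl) := by
      rw [Finset.range_orderEmbOfFin]; exact hs
    obtain ⟨⟨p, hp⟩, rfl⟩ := this
    have h : min p (S.card - 1) = p := by omega
    exact ⟨p, hp.le, by simp only [h]⟩

/-- Increments of a function over an interval, split along a sequence containing its endpoints. -/
lemma sum_increments_eq {u : ℕ → ℝ≥0} (hu : Monotone u) {N p q : ℕ} (hq : q ≤ N)
    (h : u p ≤ u q) (G : ℝ≥0 → ℝ) :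
    ∑ i ∈ Finset.range N, (if u p ≤ u i ∧ u i < u q then G (u (i + 1)) - G (u i) else 0)
      = G (u q) - G (u p) := by
  -- Each summand is an increment of `G` along `u` clamped to `[u p, u q]`, so the sum telescopes.
  have key : ∀ i, (if u p ≤ u i ∧ u i < u q then G (u (i + 1)) - G (u i) else 0)
      = G (max (u p) (min (u (i + 1)) (u q))) - G (max (u p) (min (u i) (u q))) := by
    intro i
    have hi : u i ≤ u (i + 1) := hu (Nat.le_succ i)
    split_ifs with hc
    · have h1 : u (i + 1) ≤ u q := by
        by_contra hcon
        have : q < i + 1 := hu.reflect_lt (not_le.1 hcon)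
        exact absurd (hu (Nat.lt_succ_iff.1 this)) (not_le.2 hc.2)
      rw [min_eq_left h1, min_eq_left hc.2.le, max_eq_right hc.1, max_eq_right (hc.1.trans hi)]
    · rcases lt_or_ge (u i) (u p) with h1 | h1
      · have h2 : u (i + 1) ≤ u p := hu (Nat.succ_le_of_lt (hu.reflect_lt h1))
        rw [max_eq_left ((min_le_left _ _).trans h2), max_eq_left ((min_le_left _ _).trans h1.le)]
        simp
      · have h2 : u q ≤ u i := not_lt.1 fun h3 => hc ⟨h1, h3⟩
        rw [min_eq_right h2, min_eq_right (h2.trans hi)]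
        simp
  rw [Finset.sum_congr rfl fun i _ => key i,
    Finset.sum_range_sub fun i => G (max (u p) (min (u i) (u q)))]
  have h0 : u 0 ≤ u p := hu (Nat.zero_le p)
  rw [min_eq_right (hu hq), max_eq_right h, max_eq_left ((min_le_left _ _).trans h0)]

namespace SimpleProcess

/-- The integral of a simple process against the increments of a function. -/
noncomputable def pair (K : SimpleProcess 𝓕) (ω : Ω) (G : ℝ≥0 → ℝ) : ℝ :=
  ∑ i ∈ Finset.range K.n, K.coef i ω * (G (K.time (i + 1)) - G (K.time i))

lemma integral_eq_pair (K : SimpleProcess 𝓕) (Z : ℝ≥0 → Ω → ℝ) (T : ℝ≥0) (ω : Ω) :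
    K.integral Z T ω = K.pair ω fun u => Z (min u T) ω := rfl

/-- The indicator of `(a, b]` at `t` is the increment of `u ↦ 1_{t ≤ u}`. Hence an identity proved
once for `pair` transfers to values and to integrals alike. -/
lemma value_eq_pair (K : SimpleProcess 𝓕) (t : ℝ≥0) (ω : Ω) :
    K.value t ω = K.pair ω fun u => if t ≤ u then 1 else 0 := by
  unfold value pair
  refine Finset.sum_congr rfl fun i _ => ?_
  have hi : K.time i ≤ K.time (i + 1) := K.time_mono (Nat.le_succ i)
  by_cases h1 : t ≤ K.time i
  · simp [h1, h1.trans hi, not_lt.2 h1]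
  · by_cases h2 : t ≤ K.time (i + 1)
    · simp [h1, h2, not_le.1 h1]
    · simp [h1, h2]

lemma pair_sub (K : SimpleProcess 𝓕) (ω : Ω) (G G' : ℝ≥0 → ℝ) :
    K.pair ω (fun u => G u - G' u) = K.pair ω G - K.pair ω G' := by
  simp only [pair, ← Finset.sum_sub_distrib]
  exact Finset.sum_congr rfl fun i _ => by ring

lemma pair_add_const (K : SimpleProcess 𝓕) (ω : Ω) (G : ℝ≥0 → ℝ) (c : ℝ) :
    K.pair ω (fun u => G u + c) = K.pair ω G := by
  simp [pair]

lemma pair_const (K : SimpleProcess 𝓕) (ω : Ω) (c : ℝ) :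
    K.pair ω (fun _ => c) = 0 := by
  simp [pair]

/-- A finite sum of adapted rectangles is a simple process. -/
lemma exists_of_rectangles {ι : Type*} (s : Finset ι) (a b : ι → ℝ≥0) (c : ι → Ω → ℝ)
    (hab : ∀ l ∈ s, a l ≤ b l) (hm : ∀ l ∈ s, Measurable[𝓕 (a l)] (c l))
    (hb : ∀ l ∈ s, ∃ C : ℝ, ∀ ω, |c l ω| ≤ C) :
    ∃ K : SimpleProcess 𝓕, ∀ ω G, K.pair ω G = ∑ l ∈ s, c l ω * (G (b l) - G (a l)) := by
  classical
  obtain ⟨u, N, hu, hS⟩ := exists_monotone_enumeration (s.image a ∪ s.image b)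
  choose! C hC using hb
  -- On a cell of the common refinement the coefficient sums the rectangles covering it; each of
  -- these starts no later than the cell, whence adaptedness.
  refine ⟨⟨N, u, hu, fun i ω => ∑ l ∈ s, if a l ≤ u i ∧ u i < b l then c l ω else 0, ?_,
    ∑ l ∈ s, |C l|, ?_⟩, ?_⟩
  · intro i
    refine Finset.measurable_fun_sum s fun l hl => ?_
    split_ifs with h
    · exact (hm l hl).mono (𝓕.mono h.1) le_rfl
    · exact measurable_const
  · intro i ω
    refine (Finset.abs_sum_le_sum_abs _ _).trans (Finset.sum_le_sum fun l hl => ?_)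
    split_ifs
    · exact (hC l hl ω).trans (le_abs_self _)
    · simp
  · intro ω G
    simp only [pair, Finset.sum_mul]
    rw [Finset.sum_comm]
    refine Finset.sum_congr rfl fun l hl => ?_
    obtain ⟨p, -, hpa⟩ := hS (a l) (by
      simp only [Finset.mem_union, Finset.mem_image]; exact Or.inl ⟨l, hl, rfl⟩)
    obtain ⟨q, hq, hqb⟩ := hS (b l) (by
      simp only [Finset.mem_union, Finset.mem_image]; exact Or.inr ⟨l, hl, rfl⟩)
    have := sum_increments_eq hu hq (by rw [hpa, hqb]; exact hab l hl) G
    rw [hpa, hqb] at this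
    rw [← this, Finset.mul_sum]
    refine Finset.sum_congr rfl fun i _ => ?_
    split_ifs <;> simp

lemma exists_add (K K' : SimpleProcess 𝓕) :
    ∃ R : SimpleProcess 𝓕, ∀ ω G, R.pair ω G = K.pair ω G + K'.pair ω G := by
  obtain ⟨C, hC⟩ := K.coef_bounded
  obtain ⟨C', hC'⟩ := K'.coef_bounded
  obtain ⟨R, hR⟩ := exists_of_rectangles (𝓕 := 𝓕)
    ((Finset.range K.n).disjSum (Finset.range K'.n))
    (Sum.elim K.time K'.time) (Sum.elim (fun i => K.time (i + 1)) fun i => K'.time (i + 1))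
    (Sum.elim K.coef K'.coef)
    (by rintro (i | i) - <;> [exact K.time_mono (Nat.le_succ i);
      exact K'.time_mono (Nat.le_succ i)])
    (by rintro (i | i) - <;> [exact K.coef_measurable i; exact K'.coef_measurable i])
    (by rintro (i | i) - <;> [exact ⟨C, hC i⟩; exact ⟨C', hC' i⟩])
  refine ⟨R, fun ω G => ?_⟩
  rw [hR, Finset.sum_disjSum]
  rfl

/-- The simple process `c 1_(s, t] K`, for an `𝓕 s`-measurable bounded variable `c`. -/
lemma exists_restrict (K : SimpleProcess 𝓕) {s t : ℝ≥0} {c : Ω → ℝ}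
    (hc : Measurable[𝓕 s] c) {B : ℝ} (hB : ∀ ω, |c ω| ≤ B) :
    ∃ R : SimpleProcess 𝓕, ∀ ω G,
      R.pair ω G = c ω * K.pair ω (fun u => G (max s (min u t))) := by
  obtain ⟨C, hC⟩ := K.coef_bounded
  obtain ⟨R, hR⟩ := exists_of_rectangles (𝓕 := 𝓕) (Finset.range K.n)
    (fun i => max s (min (K.time i) t)) (fun i => max s (min (K.time (i + 1)) t))
    -- Past `t` the clamped interval is degenerate and contributes nothing. The coefficient must
    -- still be set to 0, as `coef i` need not be measurable at the clamped, earlier time.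
    (fun i ω => if K.time i ≤ t then c ω * K.coef i ω else 0)
    (fun i _ => by have := K.time_mono (Nat.le_succ i); gcongr)
    (fun i _ => by
      split_ifs with h
      · refine (hc.mono (𝓕.mono (le_max_left _ _)) le_rfl).mul
          ((K.coef_measurable i).mono (𝓕.mono ?_) le_rfl)
        rw [min_eq_left h]; exact le_max_right _ _
      · exact measurable_const)
    (fun i _ => ⟨B * |C|, fun ω => by
      have hB0 : 0 ≤ B := (abs_nonneg _).trans (hB ω)
      split_ifs
      · rw [abs_mul]
        exact mul_le_mul (hB ω) ((hC i ω).trans (le_abs_self _)) (abs_nonneg _) hB0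
      · simpa using mul_nonneg hB0 (abs_nonneg C)⟩)
  refine ⟨R, fun ω G => ?_⟩
  rw [hR, pair, Finset.mul_sum]
  refine Finset.sum_congr rfl fun i _ => ?_
  split_ifs with h
  · ring
  · have h1 := (not_le.1 h).le
    rw [min_eq_right h1, min_eq_right (h1.trans (K.time_mono (Nat.le_succ i)))]
    simp

lemma exists_smul (K : SimpleProcess 𝓕) (c : ℝ) :
    ∃ R : SimpleProcess 𝓕, ∀ ω G, R.pair ω G = c * K.pair ω G := by
  obtain ⟨C, hC⟩ := K.coef_bounded
  refine ⟨⟨K.n, K.time, K.time_mono, fun i ω => c * K.coef i ω,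
    fun i => (K.coef_measurable i).const_mul c, |c| * C, fun i ω => ?_⟩, fun ω G => ?_⟩
  · rw [abs_mul]
    exact mul_le_mul_of_nonneg_left (hC i ω) (abs_nonneg c)
  · simp only [pair, Finset.mul_sum]
    exact Finset.sum_congr rfl fun i _ => by ring

lemma value_eq_coef (K : SimpleProcess 𝓕) {i : ℕ} (hi : i < K.n) {t : ℝ≥0}
    (ht : t ∈ Set.Ioc (K.time i) (K.time (i + 1))) (ω : Ω) : K.value t ω = K.coef i ω := by
  unfold value
  rw [Finset.sum_eq_single_of_mem i (Finset.mem_range.2 hi), Set.indicator_of_mem ht]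
  intro j _ hj
  refine Set.indicator_of_notMem (fun h => ?_) _
  rcases lt_or_gt_of_ne hj with h' | h'
  · exact absurd ht.1 (not_lt.2 (h.2.trans (K.time_mono (Nat.succ_le_of_lt h'))))
  · exact absurd h.1 (not_lt.2 (ht.2.trans (K.time_mono (Nat.succ_le_of_lt h'))))

/-- The intervals are disjoint because the times are monotone, so squaring produces no cross terms.
-/
lemma value_sq (K : SimpleProcess 𝓕) (t : ℝ≥0) (ω : Ω) :
    K.value t ω ^ 2 = ∑ i ∈ Finset.range K.n,
      (Set.Ioc (K.time i) (K.time (i + 1))).indicator (fun _ => K.coef i ω ^ 2) t := by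
  by_cases h : ∃ i < K.n, t ∈ Set.Ioc (K.time i) (K.time (i + 1))
  · obtain ⟨i, hi, ht⟩ := h
    rw [K.value_eq_coef hi ht]
    rw [Finset.sum_eq_single_of_mem i (Finset.mem_range.2 hi), Set.indicator_of_mem ht]
    intro j _ hj
    refine Set.indicator_of_notMem (fun h => ?_) _
    rcases lt_or_gt_of_ne hj with h' | h'
    · exact absurd ht.1 (not_lt.2 (h.2.trans (K.time_mono (Nat.succ_le_of_lt h'))))
    · exact absurd h.1 (not_lt.2 (ht.2.trans (K.time_mono (Nat.succ_le_of_lt h'))))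
  · push Not at h
    unfold value
    rw [Finset.sum_eq_zero, Finset.sum_eq_zero]
    · simp
    · exact fun i hi => Set.indicator_of_notMem (h i (Finset.mem_range.1 hi)) _
    · exact fun i hi => Set.indicator_of_notMem (h i (Finset.mem_range.1 hi)) _

lemma measurable_coef (K : SimpleProcess 𝓕) (i : ℕ) : Measurable (K.coef i) :=
  (K.coef_measurable i).mono (𝓕.le _) le_rfl

lemma measurable_value (K : SimpleProcess 𝓕) :
    Measurable fun p : ℝ × Ω => K.value p.1.toNNReal p.2 := by
  unfold value
  refine Finset.measurable_fun_sum _ fun i _ => ?_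
  have h : MeasurableSet {p : ℝ × Ω | p.1.toNNReal ∈ Set.Ioc (K.time i) (K.time (i + 1))} :=
    (measurable_real_toNNReal.comp measurable_fst) measurableSet_Ioc
  exact ((K.measurable_coef i).comp measurable_snd).indicator h

end SimpleProcess

/-! ### Quadratic variation of simple processes and Wiener increments -/

/-- The integral of `h²` over `(0, T]`. -/
noncomputable def sqInt (T : ℝ≥0) (h : ℝ≥0 → ℝ) : ℝ≥0∞ :=
  ∫⁻ t in Set.Ioc (0 : ℝ) T, ENNReal.ofReal (h t.toNNReal ^ 2)

/-- The integral over `(0, T]` of the square of a simple process, as a finite sum. -/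
lemma sqInt_value (K : SimpleProcess 𝓕) (T : ℝ≥0) (ω : Ω) :
    sqInt T (fun t => K.value t ω) = ENNReal.ofReal (∑ i ∈ Finset.range K.n,
      K.coef i ω ^ 2 * ((min (K.time (i + 1)) T : ℝ≥0) - (min (K.time i) T : ℝ≥0) : ℝ)) := by
  have hmin : ∀ i, (min (K.time i) T : ℝ≥0) ≤ (min (K.time (i + 1)) T : ℝ≥0) := fun i =>
    min_le_min_right _ (K.time_mono (Nat.le_succ i))
  unfold sqInt
  simp only [K.value_sq]
  rw [ENNReal.ofReal_sum_of_nonneg fun i _ => mul_nonneg (sq_nonneg _)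
    (sub_nonneg.2 (by exact_mod_cast hmin i))]
  have h1 : ∀ t : ℝ, ENNReal.ofReal (∑ i ∈ Finset.range K.n,
      (Set.Ioc (K.time i) (K.time (i + 1))).indicator (fun _ => K.coef i ω ^ 2) t.toNNReal)
      = ∑ i ∈ Finset.range K.n, (Real.toNNReal ⁻¹' (Set.Ioc (K.time i) (K.time (i + 1)))).indicator
        (fun _ => ENNReal.ofReal (K.coef i ω ^ 2)) t := by
    intro t
    rw [ENNReal.ofReal_sum_of_nonneg fun i _ => Set.indicator_nonneg (fun _ _ => sq_nonneg _) _]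
    refine Finset.sum_congr rfl fun i _ => ?_
    by_cases h : t.toNNReal ∈ Set.Ioc (K.time i) (K.time (i + 1))
    · rw [Set.indicator_of_mem h, Set.indicator_of_mem (by exact h)]
    · rw [Set.indicator_of_notMem h, Set.indicator_of_notMem (by exact h)]; simp
  simp only [h1]
  have hms : ∀ i, MeasurableSet (Real.toNNReal ⁻¹' (Set.Ioc (K.time i) (K.time (i + 1)))) :=
    fun i => measurable_real_toNNReal measurableSet_Ioc
  rw [lintegral_finsetSum _ fun i _ => measurable_const.indicator (hms i)]
  refine Finset.sum_congr rfl fun i _ => ?_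
  rw [lintegral_indicator (hms i), lintegral_const, Measure.restrict_apply MeasurableSet.univ,
    Measure.restrict_apply (MeasurableSet.univ.inter (hms i)),
    ENNReal.ofReal_mul (sq_nonneg _), Set.univ_inter]
  congr 1
  rw [← Real.volume_Ioc]
  congr 1
  ext t
  simp only [Set.mem_inter_iff, Set.mem_preimage, Set.mem_Ioc, NNReal.coe_min, inf_lt_iff, le_inf_iff]
  constructor
  · rintro ⟨⟨h1, h2⟩, h3, h4⟩
    rw [Real.lt_toNNReal_iff_coe_lt] at h1
    rw [Real.toNNReal_le_iff_le_coe] at h2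
    exact ⟨Or.inl h1, h2, h4⟩
  · rintro ⟨h1 | h1, h2, h3⟩
    · rw [Real.lt_toNNReal_iff_coe_lt, Real.toNNReal_le_iff_le_coe]
      exact ⟨⟨h1, h2⟩, (K.time i).coe_nonneg.trans_lt h1, h3⟩
    · exact absurd h3 (not_le.2 h1)

namespace IsWienerProcess

lemma measurable (hW : IsWienerProcess 𝓕 P W) (t : ℝ≥0) : Measurable (W t) :=
  (hW.adapted t).measurable.mono (𝓕.le t) le_rfl

lemma indepFun_increment (hW : IsWienerProcess 𝓕 P W) {a b : ℝ≥0} (hab : a ≤ b) {f : Ω → ℝ}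
    (hf : Measurable[𝓕 a] f) : IndepFun f (fun ω => W b ω - W a ω) P := by
  rw [IndepFun_iff_Indep]
  have h := hW.indep a b hab
  rw [← BorelSpace.measurable_eq] at h
  exact (indep_of_indep_of_le_right h hf.comap_le).symm

lemma hasLaw_increment (hW : IsWienerProcess 𝓕 P W) {a b : ℝ≥0} (hab : a ≤ b) :
    HasLaw (fun ω => W b ω - W a ω) (gaussianReal 0 (b - a)) P := by
  have h := hW.brownian.hasLaw_sub b a
  have : nndist b.1 a.1 = b - a := by
    ext
    rw [coe_nndist, Real.dist_eq, NNReal.coe_sub hab, abs_of_nonneg]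
    · rfl
    · exact sub_nonneg.2 hab
  rw [this] at h
  exact h

lemma memLp_increment (hW : IsWienerProcess 𝓕 P W) {a b : ℝ≥0} (hab : a ≤ b) :
    MemLp (fun ω => W b ω - W a ω) 2 P :=
  (hW.hasLaw_increment hab).hasGaussianLaw.memLp_two

lemma integral_increment (hW : IsWienerProcess 𝓕 P W) {a b : ℝ≥0} (hab : a ≤ b) :
    ∫ ω, (W b ω - W a ω) ∂P = 0 := by
  rw [(hW.hasLaw_increment hab).integral_eq, integral_id_gaussianReal]

lemma integral_increment_sq [IsProbabilityMeasure P] (hW : IsWienerProcess 𝓕 P W) {a b : ℝ≥0}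
    (hab : a ≤ b) : ∫ ω, (W b ω - W a ω) ^ 2 ∂P = b - a := by
  have h := (hW.hasLaw_increment hab).variance_eq
  rw [variance_id_gaussianReal, variance_of_integral_eq_zero
    (hW.memLp_increment hab).aestronglyMeasurable.aemeasurable (hW.integral_increment hab)] at h
  rw [h, NNReal.coe_sub hab]

/-- Adding `c (W b - W a)` to a square integrable `𝓕 a`-measurable variable. -/
lemma integral_add_sq [IsProbabilityMeasure P] (hW : IsWienerProcess 𝓕 P W) {a b : ℝ≥0}
    (hab : a ≤ b) {U c : Ω → ℝ} (hU : Measurable[𝓕 a] U) (hU2 : MemLp U 2 P)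
    (hc : Measurable[𝓕 a] c) {C : ℝ} (hC : ∀ ω, |c ω| ≤ C) :
    MemLp (fun ω => U ω + c ω * (W b ω - W a ω)) 2 P ∧
    ∫ ω, (U ω + c ω * (W b ω - W a ω)) ^ 2 ∂P =
      ∫ ω, U ω ^ 2 ∂P + ∫ ω, c ω ^ 2 * (b - a) ∂P := by
  have hcm : Measurable c := hc.mono (𝓕.le a) le_rfl
  have hcb : MemLp c ∞ P := memLp_top_of_bound hcm.aestronglyMeasurable C (ae_of_all _ hC)
  have hD := hW.memLp_increment hab
  have hcD : MemLp (fun ω => c ω * (W b ω - W a ω)) 2 P := hD.mul hcb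
  refine ⟨hU2.add hcD, ?_⟩
  have hUc : MemLp (fun ω => U ω * c ω) 2 P := hcb.mul hU2
  have i1 : Integrable (fun ω => U ω ^ 2) P := hU2.integrable_sq
  have i2 : Integrable (fun ω => U ω * c ω * (W b ω - W a ω)) P := hUc.integrable_mul hD
  have i3 : Integrable (fun ω => (c ω * (W b ω - W a ω)) ^ 2) P := hcD.integrable_sq
  have e : ∀ ω, (U ω + c ω * (W b ω - W a ω)) ^ 2 = U ω ^ 2
      + 2 * (U ω * c ω * (W b ω - W a ω)) + (c ω * (W b ω - W a ω)) ^ 2 := fun ω => by ring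
  have i12 : Integrable (fun ω => U ω ^ 2 + 2 * (U ω * c ω * (W b ω - W a ω))) P :=
    i1.add (i2.const_mul 2)
  simp_rw [e]
  rw [integral_add i12 i3, integral_add i1 (i2.const_mul 2),
    integral_const_mul]
  -- The cross term vanishes: `U c` is known at time `a`, hence independent of the centred
  -- increment.
  have h1 : ∫ ω, U ω * c ω * (W b ω - W a ω) ∂P = 0 := by
    have := (hW.indepFun_increment hab (hU.mul hc)).integral_fun_mul_eq_mul_integral
      hUc.aestronglyMeasurable hD.aestronglyMeasurable
    rw [hW.integral_increment hab, mul_zero] at this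
    exact this
  have h2 : ∫ ω, (c ω * (W b ω - W a ω)) ^ 2 ∂P = ∫ ω, c ω ^ 2 * (b - a) ∂P := by
    have := (hW.indepFun_increment hab hc).integral_fun_comp_mul_comp (f := fun x => x ^ 2)
      (g := fun x => x ^ 2) hcm.aemeasurable hD.aestronglyMeasurable.aemeasurable
      (by fun_prop) (by fun_prop)
    simp_rw [mul_pow]
    rw [this, hW.integral_increment_sq hab, integral_mul_const]
  rw [h1, h2]
  ring

end IsWienerProcess

/-! ### Itô isometry and a truncated Chebyshev inequality -/

namespace SimpleProcess

/-- The elementary integral of the first `n` terms of a simple process. -/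
noncomputable def partialIntegral (K : SimpleProcess 𝓕) (Z : ℝ≥0 → Ω → ℝ) (T : ℝ≥0) (n : ℕ)
    (ω : Ω) : ℝ :=
  ∑ i ∈ Finset.range n, K.coef i ω * (Z (min (K.time (i + 1)) T) ω - Z (min (K.time i) T) ω)

lemma partialIntegral_succ (K : SimpleProcess 𝓕) (Z : ℝ≥0 → Ω → ℝ) (T : ℝ≥0) (n : ℕ) (ω : Ω) :
    K.partialIntegral Z T (n + 1) ω = K.partialIntegral Z T n ω
      + K.coef n ω * (Z (min (K.time (n + 1)) T) ω - Z (min (K.time n) T) ω) :=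
  Finset.sum_range_succ _ _

lemma min_time_le (K : SimpleProcess 𝓕) (T : ℝ≥0) (i : ℕ) :
    min (K.time i) T ≤ min (K.time (i + 1)) T :=
  min_le_min_right _ (K.time_mono (Nat.le_succ i))

lemma measurable_partialIntegral (hW : IsWienerProcess 𝓕 P W) (K : SimpleProcess 𝓕)
    (T : ℝ≥0) (n : ℕ) : Measurable[𝓕 (K.time n)] (K.partialIntegral W T n) := by
  refine Finset.measurable_fun_sum _ fun i hi => ?_
  have hi' : K.time (i + 1) ≤ K.time n := K.time_mono (Finset.mem_range.1 hi)
  refine ((K.coef_measurable i).mono (𝓕.mono ((K.time_mono (Nat.le_succ i)).trans hi'))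
    le_rfl).mul (Measurable.sub ?_ ?_)
  · exact (hW.adapted _).measurable.mono (𝓕.mono ((min_le_left _ _).trans hi')) le_rfl
  · exact (hW.adapted _).measurable.mono
      (𝓕.mono ((min_le_left _ _).trans ((K.time_mono (Nat.le_succ i)).trans hi'))) le_rfl

lemma measurable_integral (hW : IsWienerProcess 𝓕 P W) (K : SimpleProcess 𝓕)
    (T : ℝ≥0) : Measurable (K.integral W T) :=
  (K.measurable_partialIntegral hW T K.n).mono (𝓕.le _) le_rfl

lemma partialIntegral_sq [IsProbabilityMeasure P] (hW : IsWienerProcess 𝓕 P W)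
    (K : SimpleProcess 𝓕) (T : ℝ≥0) (n : ℕ) :
    MemLp (K.partialIntegral W T n) 2 P ∧
    ∫ ω, K.partialIntegral W T n ω ^ 2 ∂P = ∫ ω, ∑ i ∈ Finset.range n,
      K.coef i ω ^ 2 * ((min (K.time (i + 1)) T : ℝ≥0) - (min (K.time i) T : ℝ≥0) : ℝ) ∂P := by
  obtain ⟨C, hC⟩ := K.coef_bounded
  have hint : ∀ (i : ℕ) (r : ℝ), Integrable (fun ω => K.coef i ω ^ 2 * r) P := by
    intro i r
    have : MemLp (K.coef i) 2 P :=
      (memLp_top_of_bound (K.measurable_coef i).aestronglyMeasurable C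
        (ae_of_all _ (hC i))).mono_exponent le_top
    exact this.integrable_sq.mul_const r
  induction n with
  | zero =>
    have : K.partialIntegral W T 0 = fun _ => 0 := by ext; simp [partialIntegral]
    rw [this]
    simp
  | succ n ih =>
    have e : K.partialIntegral W T (n + 1) = fun ω => K.partialIntegral W T n ω
      + K.coef n ω * (W (min (K.time (n + 1)) T) ω - W (min (K.time n) T) ω) :=
        funext fun ω => K.partialIntegral_succ W T n ω
    simp only [Finset.sum_range_succ]
    rw [integral_add (integrable_finsetSum _ fun i _ => hint i _) (hint n _), ← ih.2, e]
    -- If `time n` exceeds `T`, both stopped times equal `T` and the new term is zero; otherwise the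
    -- stopped left endpoint is `time n`, where the past is measurable.
    rcases le_total (K.time n) T with h | h
    · have := hW.integral_add_sq (K.min_time_le T n) (U := K.partialIntegral W T n)
        (c := K.coef n) (C := C) (by rw [min_eq_left h]; exact K.measurable_partialIntegral hW T n)
        ih.1 (by rw [min_eq_left h]; exact K.coef_measurable n) (hC n)
      exact this
    · have h' : T ≤ K.time (n + 1) := h.trans (K.time_mono (Nat.le_succ n))
      simp only [min_eq_right h, min_eq_right h', sub_self, mul_zero, add_zero, integral_zero]
      exact ⟨ih.1, trivial⟩

lemma memLp_integral [IsProbabilityMeasure P] (hW : IsWienerProcess 𝓕 P W)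
    (K : SimpleProcess 𝓕) (T : ℝ≥0) : MemLp (K.integral W T) 2 P :=
  (K.partialIntegral_sq hW T K.n).1

/-- The Itô isometry for simple processes. -/
lemma lintegral_integral_sq [IsProbabilityMeasure P] (hW : IsWienerProcess 𝓕 P W)
    (K : SimpleProcess 𝓕) (T : ℝ≥0) :
    ∫⁻ ω, ENNReal.ofReal (K.integral W T ω ^ 2) ∂P = ∫⁻ ω, sqInt T (fun t => K.value t ω) ∂P := by
  obtain ⟨C, hC⟩ := K.coef_bounded
  have hint : ∀ (i : ℕ) (r : ℝ), Integrable (fun ω => K.coef i ω ^ 2 * r) P := by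
    intro i r
    have : MemLp (K.coef i) 2 P :=
      (memLp_top_of_bound (K.measurable_coef i).aestronglyMeasurable C
        (ae_of_all _ (hC i))).mono_exponent le_top
    exact this.integrable_sq.mul_const r
  have h := (K.partialIntegral_sq hW T K.n).2
  simp only [sqInt_value]
  rw [← ofReal_integral_eq_lintegral_ofReal (K.memLp_integral hW T).integrable_sq
      (ae_of_all _ fun _ => sq_nonneg _),
    ← ofReal_integral_eq_lintegral_ofReal (integrable_finsetSum _ fun i _ => hint i _)
      (ae_of_all _ fun ω => Finset.sum_nonneg fun i _ => mul_nonneg (sq_nonneg _)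
        (sub_nonneg.2 (by exact_mod_cast K.min_time_le T i))), ← h]
  rfl

/-- Chebyshev's inequality for the integral of a simple process, with truncation of the
quadratic variation. -/
lemma measure_le_abs_integral [IsProbabilityMeasure P] (hW : IsWienerProcess 𝓕 P W)
    (K : SimpleProcess 𝓕) (T : ℝ≥0) {δ η : ℝ} (hδ : 0 < δ) (hη : 0 ≤ η) :
    P {ω | δ ≤ |K.integral W T ω|} ≤
      P {ω | ENNReal.ofReal η < sqInt T (fun t => K.value t ω)} + ENNReal.ofReal (η / δ ^ 2) := by
  classical
  set d : ℕ → ℝ := fun i => (min (K.time (i + 1)) T : ℝ≥0) - (min (K.time i) T : ℝ≥0) with hd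
  have hd0 : ∀ i, 0 ≤ d i := fun i => sub_nonneg.2 (by exact_mod_cast K.min_time_le T i)
  -- The running quadratic variation includes term `i` itself, yet is already known at `time i`.
  set A : ℕ → Ω → ℝ := fun i ω => ∑ l ∈ Finset.range (i + 1), K.coef l ω ^ 2 * d l with hA
  have hAm : ∀ i, Measurable[𝓕 (K.time i)] (A i) := fun i =>
    Finset.measurable_fun_sum _ fun l hl => (((K.coef_measurable l).mono
      (𝓕.mono (K.time_mono (Nat.lt_succ_iff.1 (Finset.mem_range.1 hl))))
      le_rfl).pow_const 2).mul_const _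
  obtain ⟨C, hC⟩ := K.coef_bounded
  -- `R` switches `K` off once the quadratic variation passes `η`. Its own variation is at most `η`
  -- everywhere, so isometry and Chebyshev apply, and it agrees with `K` where the total variation
  -- is at most `η`.
  let R : SimpleProcess 𝓕 := ⟨K.n, K.time, K.time_mono,
    fun i ω => if A i ω ≤ η then K.coef i ω else 0,
    fun i => Measurable.ite ((hAm i) measurableSet_Iic) (K.coef_measurable i) measurable_const,
    C, fun i ω => by
      split_ifs
      · exact hC i ω
      · simpa using (abs_nonneg _).trans (hC i ω)⟩
  have hRle : ∀ ω n, ∑ i ∈ Finset.range n, R.coef i ω ^ 2 * d i ≤ η := by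
    intro ω n
    induction n with
    | zero => simpa using hη
    | succ n ih =>
      by_cases h : A n ω ≤ η
      · refine le_trans (Finset.sum_le_sum fun i _ => ?_) h
        refine mul_le_mul_of_nonneg_right ?_ (hd0 i)
        simp only [R]
        split_ifs
        · exact le_rfl
        · simpa using sq_nonneg _
      · rw [Finset.sum_range_succ]
        simpa [R, h] using ih
  have hRK : ∀ ω, sqInt T (fun t => K.value t ω) ≤ ENNReal.ofReal η →
      R.integral W T ω = K.integral W T ω := by
    intro ω h
    rw [sqInt_value, ENNReal.ofReal_le_ofReal_iff hη] at h
    refine Finset.sum_congr rfl fun i hi => ?_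
    have : A i ω ≤ η := by
      refine le_trans (Finset.sum_le_sum_of_subset_of_nonneg ?_ fun l _ _ =>
        mul_nonneg (sq_nonneg _) (hd0 l)) h
      exact Finset.range_subset_range.2 (Finset.mem_range.1 hi)
    simp [R, this]
  have hsub : {ω | δ ≤ |K.integral W T ω|} ⊆
      {ω | ENNReal.ofReal η < sqInt T (fun t => K.value t ω)} ∪
      {ω | ENNReal.ofReal (δ ^ 2) ≤ ENNReal.ofReal (R.integral W T ω ^ 2)} := by
    intro ω hω
    by_cases h : ENNReal.ofReal η < sqInt T (fun t => K.value t ω)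
    · exact Or.inl h
    · refine Or.inr ?_
      simp only [Set.mem_ofPred_eq] at hω ⊢
      rw [hRK ω (not_lt.1 h), ← sq_abs (K.integral W T ω)]
      exact ENNReal.ofReal_le_ofReal (pow_le_pow_left₀ hδ.le hω 2)
  refine (measure_mono hsub).trans ((measure_union_le _ _).trans (add_le_add le_rfl ?_))
  have hδ2 : 0 < δ ^ 2 := by positivity
  refine (meas_ge_le_lintegral_div
    ((R.measurable_integral hW T).pow_const 2).ennreal_ofReal.aemeasurable
    (by simpa using hδ.ne') ENNReal.ofReal_ne_top).trans ?_
  rw [ENNReal.ofReal_div_of_pos hδ2]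
  refine ENNReal.div_le_div_right ?_ _
  rw [R.lintegral_integral_sq hW T]
  calc ∫⁻ ω, sqInt T (fun t => R.value t ω) ∂P ≤ ∫⁻ _, ENNReal.ofReal η ∂P := by
        refine lintegral_mono fun ω => ?_
        rw [sqInt_value]
        exact ENNReal.ofReal_le_ofReal (hRle ω K.n)
    _ = ENNReal.ofReal η := by simp

end SimpleProcess

/-! ### Convergence in probability and squared time integrals -/

/-- Convergence to zero in probability of a sequence of extended nonnegative variables. -/
def TendstoZero (P : Measure Ω) (D : ℕ → Ω → ℝ≥0∞) : Prop :=
  ∀ δ : ℝ≥0∞, 0 < δ → Tendsto (fun n => P {ω | δ ≤ D n ω}) atTop (𝓝 0)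

lemma TendstoZero.of_le {D A : ℕ → Ω → ℝ≥0∞} (hA : TendstoZero P A)
    (h : ∀ n, ∀ᵐ ω ∂P, D n ω ≤ A n ω) : TendstoZero P D := by
  intro δ hδ
  refine tendsto_of_tendsto_of_tendsto_of_le_of_le tendsto_const_nhds (hA δ hδ)
    (fun _ => zero_le) fun n => measure_mono_ae ?_
  filter_upwards [h n] with ω hω h' using le_trans (show δ ≤ D n ω from h') hω

lemma TendstoZero.add {A B : ℕ → Ω → ℝ≥0∞} (hA : TendstoZero P A) (hB : TendstoZero P B) :
    TendstoZero P fun n ω => A n ω + B n ω := by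
  intro δ hδ
  have hδ2 : 0 < δ / 2 := ENNReal.half_pos hδ.ne'
  have := (hA _ hδ2).add (hB _ hδ2)
  rw [add_zero] at this
  refine tendsto_of_tendsto_of_tendsto_of_le_of_le tendsto_const_nhds this
    (fun _ => zero_le) fun n => ?_
  refine (measure_mono fun ω hω => ?_).trans (measure_union_le _ _)
  by_contra hcon
  simp only [Set.mem_union, Set.mem_ofPred_eq, not_or, not_le] at hcon hω
  have h' := ENNReal.add_lt_add hcon.1 hcon.2
  rw [ENNReal.add_halves] at h'
  exact absurd hω (not_le.2 h')

lemma TendstoZero.const_mul {A : ℕ → Ω → ℝ≥0∞} (hA : TendstoZero P A) {c : ℝ≥0∞} (hc : c ≠ ∞) :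
    TendstoZero P fun n ω => c * A n ω := by
  intro δ hδ
  rcases eq_or_ne c 0 with rfl | h0
  · simp [not_le.2 hδ]
  refine (hA (δ / c) (ENNReal.div_pos hδ.ne' hc)).congr fun n => ?_
  congr 1
  ext ω
  simp only [Set.mem_ofPred_eq]
  rw [ENNReal.div_le_iff h0 hc, mul_comm]

lemma TendstoZero.of_tendsto {d : ℕ → ℝ≥0∞} (h : Tendsto d atTop (𝓝 0)) :
    TendstoZero P fun n _ => d n := by
  intro δ hδ
  refine tendsto_const_nhds.congr' ?_
  filter_upwards [h.eventually_lt_const hδ] with n hn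
  simp [not_le.2 hn]

lemma tendstoInMeasure_iff {I : ℕ → Ω → ℝ} {J : Ω → ℝ} :
    TendstoInMeasure P I atTop J ↔ TendstoZero P fun n ω => edist (I n ω) (J ω) := Iff.rfl

/-- Measurability in time on `(0, T]`. -/
def TimeMeasurable (T : ℝ≥0) (h : ℝ≥0 → ℝ) : Prop :=
  AEMeasurable (fun t : ℝ => h t.toNNReal) (volume.restrict (Set.Ioc (0 : ℝ) T))

/-- Equality for almost every time in `(0, T]`. -/
def TimeEq (T : ℝ≥0) (h g : ℝ≥0 → ℝ) : Prop :=
  ∀ᵐ t : ℝ ∂volume.restrict (Set.Ioc (0 : ℝ) T), h t.toNNReal = g t.toNNReal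

lemma TimeEq.of_forall {T : ℝ≥0} {h g : ℝ≥0 → ℝ} (H : ∀ t, 0 < t → t ≤ T → h t = g t) :
    TimeEq T h g := by
  refine (ae_restrict_iff' measurableSet_Ioc).2 (ae_of_all _ fun t ht => H _ ?_ ?_)
  · simpa using ht.1
  · rw [Real.toNNReal_le_iff_le_coe]; exact ht.2

lemma sqInt_congr {T : ℝ≥0} {h g : ℝ≥0 → ℝ} (H : TimeEq T h g) : sqInt T h = sqInt T g := by
  refine lintegral_congr_ae ?_
  filter_upwards [H] with t ht
  simp only [ht]

lemma sqInt_mono {s T : ℝ≥0} (hs : s ≤ T) (h : ℝ≥0 → ℝ) : sqInt s h ≤ sqInt T h :=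
  lintegral_mono_set (Set.Ioc_subset_Ioc_right (by exact_mod_cast hs))

lemma sqInt_le {T : ℝ≥0} {h g : ℝ≥0 → ℝ} (H : ∀ t, |h t| ≤ |g t|) : sqInt T h ≤ sqInt T g :=
  lintegral_mono fun _ => ENNReal.ofReal_le_ofReal (sq_le_sq.2 (H _))

lemma sqInt_add_le {T : ℝ≥0} {f g h : ℝ≥0 → ℝ} (hf : TimeMeasurable T f)
    (hh : ∀ t, h t = f t + g t) : sqInt T h ≤ 2 * (sqInt T f + sqInt T g) := by
  unfold sqInt
  rw [← lintegral_add_left' (hf.pow_const 2).ennreal_ofReal, ← lintegral_const_mul' _ _ (by simp)]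
  refine lintegral_mono fun t => ?_
  rw [← ENNReal.ofReal_add (sq_nonneg _) (sq_nonneg _),
    show (2 : ℝ≥0∞) = ENNReal.ofReal 2 by simp, ← ENNReal.ofReal_mul (by norm_num), hh]
  refine ENNReal.ofReal_le_ofReal ?_
  nlinarith [sq_nonneg (f t.toNNReal - g t.toNNReal)]

lemma sqInt_const_mul (T : ℝ≥0) (c : ℝ) (h : ℝ≥0 → ℝ) :
    sqInt T (fun t => c * h t) = ENNReal.ofReal (c ^ 2) * sqInt T h := by
  unfold sqInt
  rw [← lintegral_const_mul' _ _ ENNReal.ofReal_ne_top]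
  refine lintegral_congr fun t => ?_
  rw [← ENNReal.ofReal_mul (sq_nonneg _), mul_pow]

lemma SimpleProcess.timeMeasurable_value (K : SimpleProcess 𝓕) (T : ℝ≥0) (ω : Ω) :
    TimeMeasurable T fun t => K.value t ω :=
  (K.measurable_value.comp (measurable_id.prodMk measurable_const)).aemeasurable

/-! ### Itô integrals as limits of simple integrals -/

/-- `I` is the limit in probability of integrals over `(0, T]` of simple processes converging
to `H`. -/
structure IsItoLimit (𝓕 : Filtration ℝ≥0 mΩ) (P : Measure Ω) (W : ℝ≥0 → Ω → ℝ) (T : ℝ≥0)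
    (H : ℝ≥0 → Ω → ℝ) (I : Ω → ℝ) : Prop where
  measurable : ∀ ω, TimeMeasurable T fun t => H t ω
  approx : ∃ K : ℕ → SimpleProcess 𝓕,
    TendstoZero P (fun n ω => sqInt T fun t => (K n).value t ω - H t ω) ∧
    TendstoInMeasure P (fun n => (K n).integral W T) atTop I

namespace IsItoLimit

variable {T : ℝ≥0} {H H' : ℝ≥0 → Ω → ℝ} {I I' : Ω → ℝ}

lemma of_simple (K : SimpleProcess 𝓕) (T : ℝ≥0) :
    IsItoLimit 𝓕 P W T (fun t ω => K.value t ω) (K.integral W T) := by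
  refine ⟨fun ω => K.timeMeasurable_value T ω, fun _ => K, ?_, ?_⟩
  · intro δ hδ
    simp [sqInt, not_le.2 hδ]
  · intro δ hδ
    simp [not_le.2 hδ]

lemma congr (h : IsItoLimit 𝓕 P W T H I) (hH : ∀ ω, TimeEq T (fun t => H t ω) fun t => H' t ω)
    (hI : I =ᵐ[P] I') : IsItoLimit 𝓕 P W T H' I' := by
  obtain ⟨K, hK, hKI⟩ := h.approx
  refine ⟨fun ω => (h.measurable ω).congr (hH ω), K, ?_, hKI.congr_right hI⟩
  refine hK.of_le fun n => ae_of_all _ fun ω => le_of_eq (sqInt_congr ?_)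
  filter_upwards [hH ω] with t ht
  simp only [ht]

lemma add (h : IsItoLimit 𝓕 P W T H I) (h' : IsItoLimit 𝓕 P W T H' I') :
    IsItoLimit 𝓕 P W T (fun t ω => H t ω + H' t ω) fun ω => I ω + I' ω := by
  obtain ⟨K, hK, hKI⟩ := h.approx
  obtain ⟨K', hK', hKI'⟩ := h'.approx
  choose R hR using fun n => (K n).exists_add (K' n)
  refine ⟨fun ω => (h.measurable ω).add (h'.measurable ω), R, ?_, ?_⟩
  · refine ((hK.add hK').const_mul (c := 2) (by simp)).of_le fun n => ae_of_all _ fun ω => ?_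
    refine sqInt_add_le (((K n).timeMeasurable_value T ω).sub (h.measurable ω)) fun t => ?_
    rw [(R n).value_eq_pair, hR, ← SimpleProcess.value_eq_pair, ← SimpleProcess.value_eq_pair]
    ring
  · rw [tendstoInMeasure_iff] at *
    refine (hKI.add hKI').of_le fun n => ae_of_all _ fun ω => ?_
    rw [(R n).integral_eq_pair, hR]
    exact edist_add_add_le _ _ _ _

lemma const_mul (h : IsItoLimit 𝓕 P W T H I) (c : ℝ) :
    IsItoLimit 𝓕 P W T (fun t ω => c * H t ω) fun ω => c * I ω := by
  obtain ⟨K, hK, hKI⟩ := h.approx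
  choose R hR using fun n => (K n).exists_smul c
  refine ⟨fun ω => (h.measurable ω).const_mul c, R, ?_, ?_⟩
  · refine (hK.const_mul (c := ENNReal.ofReal (c ^ 2)) (by simp)).of_le
      fun n => ae_of_all _ fun ω => ?_
    rw [← sqInt_const_mul]
    refine le_of_eq (congrArg _ (funext fun t => ?_))
    rw [(R n).value_eq_pair, hR, ← SimpleProcess.value_eq_pair]
    ring
  · rw [tendstoInMeasure_iff] at *
    refine (hKI.const_mul (c := ENNReal.ofReal |c|) (by simp)).of_le fun n => ae_of_all _ fun ω => ?_
    rw [(R n).integral_eq_pair, hR, edist_dist, edist_dist, Real.dist_eq, Real.dist_eq,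
      ← ENNReal.ofReal_mul (abs_nonneg c), ← abs_mul, mul_sub]
    exact le_rfl

lemma sub (h : IsItoLimit 𝓕 P W T H I) (h' : IsItoLimit 𝓕 P W T H' I') :
    IsItoLimit 𝓕 P W T (fun t ω => H t ω - H' t ω) fun ω => I ω - I' ω := by
  have := h.add (h'.const_mul (-1))
  simpa only [neg_mul, one_mul, ← sub_eq_add_neg] using this

lemma zero : IsItoLimit 𝓕 P W T (fun _ _ => 0) fun _ => 0 := by
  have := (of_simple (P := P) (W := W) (𝓕 := 𝓕)
    ⟨0, fun _ => 0, monotone_const, fun _ _ => 0, fun _ => measurable_const, 0, by simp⟩ T)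
  refine this.congr (fun ω => TimeEq.of_forall fun t _ _ => ?_) (ae_of_all _ fun ω => ?_)
  · simp [SimpleProcess.value]
  · simp [SimpleProcess.integral]

lemma sum {ι : Type*} (s : Finset ι) {H : ι → ℝ≥0 → Ω → ℝ} {I : ι → Ω → ℝ}
    (h : ∀ i ∈ s, IsItoLimit 𝓕 P W T (H i) (I i)) :
    IsItoLimit 𝓕 P W T (fun t ω => ∑ i ∈ s, H i t ω) fun ω => ∑ i ∈ s, I i ω := by
  classical
  induction s using Finset.induction_on with
  | empty => simpa using zero
  | insert i s hi ih =>
    simp only [Finset.sum_insert hi]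
    exact (h i (Finset.mem_insert_self i s)).add
      (ih fun j hj => h j (Finset.mem_insert_of_mem hj))

variable [IsProbabilityMeasure P]

/-- Chebyshev's inequality with truncation of the quadratic variation. -/
lemma measure_le_abs (hW : IsWienerProcess 𝓕 P W) (h : IsItoLimit 𝓕 P W T H I) {δ η : ℝ}
    (hδ : 0 < δ) (hη : 0 < η) :
    P {ω | 2 * δ ≤ |I ω|} ≤ P {ω | ENNReal.ofReal (η / 4) ≤ sqInt T fun t => H t ω}
      + ENNReal.ofReal (η / δ ^ 2) := by
  obtain ⟨K, hK, hKI⟩ := h.approx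
  -- The level `η / 4` comes from `(a + b)² ≤ 2a² + 2b²`, as `2 (η/4 + η/4) = η`; likewise `2δ`
  -- leaves one `δ` for the simple integral and one for the approximation error.
  have hη4 : 0 < ENNReal.ofReal (η / 4) := by simpa using hη
  have hlim := ((hKI (ENNReal.ofReal δ) (by simpa using hδ)).add (hK _ hη4)).add_const
    (P {ω | ENNReal.ofReal (η / 4) ≤ sqInt T fun t => H t ω} + ENNReal.ofReal (η / δ ^ 2))
  rw [add_zero, zero_add] at hlim
  refine ge_of_tendsto' hlim fun n => ?_
  have h1 : P {ω | 2 * δ ≤ |I ω|} ≤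
      P {ω | ENNReal.ofReal δ ≤ edist ((K n).integral W T ω) (I ω)}
      + P {ω | δ ≤ |(K n).integral W T ω|} := by
    refine (measure_mono fun ω hω => ?_).trans (measure_union_le _ _)
    by_contra hcon
    simp only [Set.mem_union, Set.mem_ofPred_eq, not_or, not_le, edist_dist, Real.dist_eq] at hcon hω
    have h2 := (ENNReal.ofReal_lt_ofReal_iff hδ).1 hcon.1
    have h3 := abs_sub_abs_le_abs_sub (I ω) ((K n).integral W T ω)
    rw [abs_sub_comm] at h2
    linarith [hcon.2]
  have h2 : P {ω | ENNReal.ofReal η < sqInt T fun t => (K n).value t ω} ≤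
      P {ω | ENNReal.ofReal (η / 4) ≤ sqInt T fun t => (K n).value t ω - H t ω}
      + P {ω | ENNReal.ofReal (η / 4) ≤ sqInt T fun t => H t ω} := by
    refine (measure_mono fun ω hω => ?_).trans (measure_union_le _ _)
    by_contra hcon
    simp only [Set.mem_union, Set.mem_ofPred_eq, not_or, not_le] at hcon hω
    have h3 := sqInt_add_le (T := T) (f := fun t => (K n).value t ω - H t ω)
      (g := fun t => H t ω) (h := fun t => (K n).value t ω)
      (((K n).timeMeasurable_value T ω).sub (h.measurable ω)) fun t => by ring
    have h4 := h3.trans (mul_le_mul_right (add_le_add hcon.1.le hcon.2.le) 2)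
    rw [← ENNReal.ofReal_add (by positivity) (by positivity),
      show (2 : ℝ≥0∞) = ENNReal.ofReal 2 by simp, ← ENNReal.ofReal_mul (by norm_num)] at h4
    refine absurd (hω.trans_le h4) (not_lt.2 (ENNReal.ofReal_le_ofReal ?_))
    linarith
  have h3 := (K n).measure_le_abs_integral hW T hδ hη.le
  calc _ ≤ _ := h1
    _ ≤ _ := add_le_add le_rfl (h3.trans (add_le_add h2 le_rfl))
    _ = _ := by ring

/-- Stochastic integrals converge in probability along with their integrands. -/
lemma tendstoZero (hW : IsWienerProcess 𝓕 P W) {H : ℕ → ℝ≥0 → Ω → ℝ} {I : ℕ → Ω → ℝ}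
    (h : ∀ n, IsItoLimit 𝓕 P W T (H n) (I n))
    (hH : TendstoZero P fun n ω => sqInt T fun t => H n t ω) :
    TendstoInMeasure P I atTop fun _ => 0 := by
  rw [tendstoInMeasure_iff_norm]
  intro δ hδ
  simp only [sub_zero, Real.norm_eq_abs]
  rw [ENNReal.tendsto_nhds_zero]
  intro e he
  -- The minimum with 1 covers `e = ∞`.
  obtain ⟨η, hη, hηe⟩ : ∃ η : ℝ, 0 < η ∧ ENNReal.ofReal (η / (δ / 2) ^ 2) ≤ e / 2 := by
    have he2 : 0 < min (e / 2) 1 := lt_min (ENNReal.half_pos he.ne') one_pos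
    have hfin : min (e / 2) 1 ≠ ∞ := ne_top_of_le_ne_top ENNReal.one_ne_top (min_le_right _ _)
    refine ⟨(min (e / 2) 1).toReal * (δ / 2) ^ 2,
      mul_pos (ENNReal.toReal_pos he2.ne' hfin) (by positivity), ?_⟩
    rw [mul_div_assoc, div_self (by positivity), mul_one, ENNReal.ofReal_toReal hfin]
    exact min_le_left _ _
  filter_upwards [(hH (ENNReal.ofReal (η / 4)) (by simpa using hη)).eventually_le_const
    (ENNReal.half_pos he.ne')] with n hn
  have := (h n).measure_le_abs hW (half_pos hδ) hη
  rw [mul_div_cancel₀ _ (two_ne_zero)] at this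
  exact this.trans ((add_le_add hn hηe).trans (ENNReal.add_halves e).le)

/-- Linearity reduces this to integrands tending to zero. It also identifies limits: simple
integrals whose integrands approach `H₀` can only converge to `I₀`, up to a null set. -/
lemma tendstoInMeasure (hW : IsWienerProcess 𝓕 P W) {H : ℕ → ℝ≥0 → Ω → ℝ} {I : ℕ → Ω → ℝ}
    {H₀ : ℝ≥0 → Ω → ℝ} {I₀ : Ω → ℝ} (h : ∀ n, IsItoLimit 𝓕 P W T (H n) (I n))
    (h₀ : IsItoLimit 𝓕 P W T H₀ I₀)
    (hH : TendstoZero P fun n ω => sqInt T fun t => H n t ω - H₀ t ω) :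
    TendstoInMeasure P I atTop I₀ := by
  have := tendstoZero hW (fun n => (h n).sub h₀) hH
  rw [tendstoInMeasure_iff_norm] at this ⊢
  simpa using this

/-- The process `c 1_(s, t] H` integrates to `c (∫_0^t H dW - ∫_0^s H dW)`. -/
lemma restrict (hW : IsWienerProcess 𝓕 P W) {s t : ℝ≥0} (hst : s ≤ t) (htT : t ≤ T)
    (hT : IsItoLimit 𝓕 P W T H I)
    {Js Jt : Ω → ℝ} (hs : IsItoLimit 𝓕 P W s H Js) (ht : IsItoLimit 𝓕 P W t H Jt) {c : Ω → ℝ}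
    (hc : Measurable[𝓕 s] c) {B : ℝ} (hB : ∀ ω, |c ω| ≤ B) :
    IsItoLimit 𝓕 P W T (fun r ω => (Set.Ioc s t).indicator (fun _ => c ω) r * H r ω)
      fun ω => c ω * (Jt ω - Js ω) := by
  obtain ⟨K, hK, hKI⟩ := ht.approx
  choose R hR using fun n => (K n).exists_restrict (t := t) hc hB
  -- Approximation on `(0, t]` restricts to `(0, s]`, so the same `K n` serve at both endpoints.
  have hKs : TendstoInMeasure P (fun n => (K n).integral W s) atTop Js := by
    refine tendstoInMeasure hW (fun n => of_simple (K n) s) hs ?_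
    exact hK.of_le fun n => ae_of_all _ fun ω => sqInt_mono hst _
  have hval : ∀ n r ω, (R n).value r ω
      = (Set.Ioc s t).indicator (fun _ => c ω) r * (K n).value r ω := by
    intro n r ω
    rw [(R n).value_eq_pair, hR]
    by_cases h1 : r ≤ s
    · rw [Set.indicator_of_notMem fun h => absurd h.1 (not_lt.2 h1)]
      simp [h1, SimpleProcess.pair_const]
    by_cases h2 : r ≤ t
    · rw [Set.indicator_of_mem (Set.mem_Ioc.2 ⟨not_le.1 h1, h2⟩), (K n).value_eq_pair]
      simp [h1, h2]
    · rw [Set.indicator_of_notMem fun h => absurd h.2 h2]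
      simp [h1, h2, SimpleProcess.pair_const]
  -- Clamping `u` to `[s, t]` gives `W (u ∧ t) - W (u ∧ s) + W s`; the constant `W s` drops out of
  -- all increments.
  have hint : ∀ n ω, (R n).integral W T ω
      = c ω * ((K n).integral W t ω - (K n).integral W s ω) := by
    intro n ω
    rw [(R n).integral_eq_pair, hR, (K n).integral_eq_pair, (K n).integral_eq_pair,
      ← SimpleProcess.pair_sub, ← (K n).pair_add_const ω
        (fun u => W (min u t) ω - W (min u s) ω) (W s ω)]
    congr 2
    funext u
    rcases le_total u s with h | h
    · rw [min_eq_left (h.trans hst), min_eq_left h, max_eq_left h, min_eq_left (hst.trans htT)]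
      ring
    · rw [max_eq_right (le_min h hst), min_eq_right h, min_eq_left ((min_le_right _ _).trans htT)]
      ring
  have hcB : ∀ ω, |c ω| ≤ |B| := fun ω => (hB ω).trans (le_abs_self B)
  refine ⟨fun ω => ?_, R, ?_, ?_⟩
  · refine AEMeasurable.mul (Measurable.aemeasurable ?_) (hT.measurable ω)
    exact (measurable_const.indicator measurableSet_Ioc).comp measurable_real_toNNReal
  · refine (hK.const_mul (c := ENNReal.ofReal (|B| ^ 2)) (by simp)).of_le
      fun n => ae_of_all _ fun ω => ?_
    rw [← sqInt_const_mul]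
    -- Both processes vanish after `t`, so the error over `(0, T]` is that over `(0, t]`.
    have e : sqInt T (fun r => (R n).value r ω
        - (Set.Ioc s t).indicator (fun _ => c ω) r * H r ω)
        = sqInt t (fun r => (R n).value r ω
        - (Set.Ioc s t).indicator (fun _ => c ω) r * H r ω) := by
      unfold sqInt
      rw [← lintegral_indicator measurableSet_Ioc, ← lintegral_indicator measurableSet_Ioc]
      refine lintegral_congr fun r => ?_
      by_cases hr : r ∈ Set.Ioc (0 : ℝ) T
      · by_cases hr2 : r ≤ t
        · rw [Set.indicator_of_mem hr, Set.indicator_of_mem (Set.mem_Ioc.2 ⟨hr.1, hr2⟩)]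
        · have hr3 : r.toNNReal ∉ Set.Ioc s t :=
            fun h => hr2 ((Real.toNNReal_le_iff_le_coe).1 h.2)
          rw [Set.indicator_of_mem hr, Set.indicator_of_notMem fun h => hr2 h.2]
          simp only [hval, Set.indicator_of_notMem hr3]
          simp
      · have htT' : (t : ℝ) ≤ T := by exact_mod_cast htT
        rw [Set.indicator_of_notMem hr, Set.indicator_of_notMem fun h =>
          hr (Set.mem_Ioc.2 ⟨h.1, h.2.trans htT'⟩)]
    rw [e]
    refine sqInt_le fun r => ?_
    rw [hval, ← mul_sub, abs_mul, abs_mul, abs_abs]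
    refine mul_le_mul_of_nonneg_right ?_ (abs_nonneg _)
    by_cases h : r ∈ Set.Ioc s t
    · rw [Set.indicator_of_mem h]; exact hcB ω
    · rw [Set.indicator_of_notMem h]; simp
  · rw [tendstoInMeasure_iff] at *
    refine ((hKI.add hKs).const_mul (c := ENNReal.ofReal |B|) (by simp)).of_le
      fun n => ae_of_all _ fun ω => ?_
    rw [hint, edist_dist, edist_dist, edist_dist, Real.dist_eq, Real.dist_eq, Real.dist_eq,
      ← ENNReal.ofReal_add (abs_nonneg _) (abs_nonneg _), ← ENNReal.ofReal_mul (abs_nonneg B),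
      ← mul_sub, abs_mul]
    refine ENNReal.ofReal_le_ofReal (mul_le_mul (hcB ω) ?_ (abs_nonneg _) (abs_nonneg _))
    rw [show (K n).integral W t ω - (K n).integral W s ω - (Jt ω - Js ω)
      = ((K n).integral W t ω - Jt ω) - ((K n).integral W s ω - Js ω) by ring]
    exact abs_sub _ _

/-- Associativity of the stochastic integral for simple integrands: if `dM = H dW`, then
`∫ K dM = ∫ K H dW`. -/
lemma simple_mul (hW : IsWienerProcess 𝓕 P W) {M : ℝ≥0 → Ω → ℝ} {m₀ : ℝ}
    (hM : ∀ t ≤ T, IsItoLimit 𝓕 P W t H fun ω => M t ω - m₀) (K : SimpleProcess 𝓕) :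
    IsItoLimit 𝓕 P W T (fun t ω => K.value t ω * H t ω) (K.integral M T) := by
  obtain ⟨C, hC⟩ := K.coef_bounded
  have h : ∀ i ∈ Finset.range K.n, IsItoLimit 𝓕 P W T
      (fun r ω => (Set.Ioc (K.time i) (K.time (i + 1))).indicator (fun _ => K.coef i ω) r * H r ω)
      fun ω => K.coef i ω * (M (min (K.time (i + 1)) T) ω - M (min (K.time i) T) ω) := by
    intro i _
    have hi := K.time_mono (Nat.le_succ i)
    rcases le_total (K.time i) T with h | h
    · rw [min_eq_left h]
      refine (restrict hW (le_min hi h) (min_le_right _ _) (hM T le_rfl) (hM _ h)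
        (hM _ (min_le_right (K.time (i + 1)) T)) (K.coef_measurable i) (hC i)).congr
        (fun ω => TimeEq.of_forall fun t _ ht => ?_) (ae_of_all _ fun ω => by ring)
      simp only [Set.indicator, Set.mem_Ioc, le_min_iff, ht, and_true]
    · rw [min_eq_right h, min_eq_right (h.trans hi)]
      refine zero.congr (fun ω => TimeEq.of_forall fun t _ ht => ?_) (ae_of_all _ fun ω => by simp)
      rw [Set.indicator_of_notMem fun h' => absurd h'.1 (not_lt.2 (ht.trans h)), zero_mul]
  refine (sum _ h).congr (fun ω => TimeEq.of_forall fun t _ _ => ?_) (ae_of_all _ fun ω => rfl)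
  rw [SimpleProcess.value, Finset.sum_mul]

end IsItoLimit

/-! ### Riemann approximation of continuous adapted integrands -/

/-- The simple process taking on `(T i / N, T (i + 1) / N]` the value of `g` at `T i / N`,
truncated at level `N`. -/
noncomputable def riemannProcess (T : ℝ≥0) (g : ℝ≥0 → Ω → ℝ) (hg : ∀ t, Measurable[𝓕 t] (g t))
    (N : ℕ) : SimpleProcess 𝓕 where
  n := N
  time i := T * i / N
  time_mono i j hij := by dsimp only; gcongr
  -- Clipping gives the uniform bound that a simple process needs; on a path bounded over `[0, T]`
  -- it is inactive for large `N`.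
  coef i ω := max (-N) (min (g (T * i / N) ω) N)
  coef_measurable i := measurable_const.max ((hg _).min measurable_const)
  coef_bounded := ⟨N, fun i ω => abs_le.2
    ⟨le_max_left _ _, max_le (by linarith [(Nat.cast_nonneg N : (0 : ℝ) ≤ N)])
      (min_le_right _ _)⟩⟩

lemma exists_mem_grid {T : ℝ≥0} (hT : 0 < T) {N : ℕ} (hN : 0 < N) {t : ℝ≥0} (ht : 0 < t)
    (htT : t ≤ T) : ∃ i < N, t ∈ Set.Ioc (T * i / N) (T * (i + 1 : ℕ) / N) := by
  have hN' : (0 : ℝ≥0) < N := by exact_mod_cast hN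
  have hpos : 0 < t * N / T := by positivity
  have hc : 0 < ⌈t * N / T⌉₊ := Nat.ceil_pos.2 hpos
  have hc' : ⌈t * N / T⌉₊ - 1 + 1 = ⌈t * N / T⌉₊ := Nat.sub_add_cancel hc
  -- A ceiling minus one, since the cells are open on the left and closed on the right.
  refine ⟨⌈t * N / T⌉₊ - 1, ?_, ?_, ?_⟩
  · have : ⌈t * N / T⌉₊ ≤ N := Nat.ceil_le.2 (by
      rw [div_le_iff₀ hT, mul_comm (N : ℝ≥0)]; gcongr)
    omega
  · have h := Nat.lt_ceil.1 (show ⌈t * N / T⌉₊ - 1 < ⌈t * N / T⌉₊ by omega)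
    rw [div_lt_iff₀ hN', mul_comm]
    rwa [lt_div_iff₀ hT] at h
  · have h := Nat.le_ceil (t * N / T)
    rw [hc', le_div_iff₀ hN', mul_comm T]
    rwa [div_le_iff₀ hT] at h

lemma riemannProcess_value_eq {T : ℝ≥0} {g : ℝ≥0 → Ω → ℝ} (hg : ∀ t, Measurable[𝓕 t] (g t))
    (ω : Ω) (hT : 0 < T) {N : ℕ} (hN : 0 < N) {t : ℝ≥0} (ht : 0 < t)
    (htT : t ≤ T) : ∃ s ≤ T, dist s t ≤ T / N ∧
      (riemannProcess T g hg N).value t ω = max (-N : ℝ) (min (g s ω) N) := by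
  obtain ⟨i, hi, hti⟩ := exists_mem_grid hT hN ht htT
  refine ⟨T * i / N, hti.1.le.trans htT, ?_, ?_⟩
  · have h1 : t ≤ T * i / N + T / N := by
      refine hti.2.trans (le_of_eq ?_)
      rw [← add_div]
      push_cast
      ring
    rw [NNReal.dist_eq, abs_sub_comm, abs_of_nonneg
      (sub_nonneg.2 (by exact_mod_cast hti.1.le))]
    have h2 : (t : ℝ) ≤ ((T * i / N : ℝ≥0) : ℝ) + T / N := by exact_mod_cast h1
    linarith
  · exact (riemannProcess T g hg N).value_eq_coef hi hti ω

lemma max_neg_min_eq_self {x N : ℝ} (h : |x| ≤ N) : max (-N) (min x N) = x := by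
  rw [min_eq_left (abs_le.1 h).2, max_eq_right (abs_le.1 h).1]

lemma abs_max_neg_min_le {x N : ℝ} (hN : 0 ≤ N) : |max (-N) (min x N)| ≤ |x| := by
  rcases le_total |x| N with h | h
  · rw [max_neg_min_eq_self h]
  · refine le_trans (abs_le.2 ⟨le_max_left _ _, max_le (by linarith) (min_le_right _ _)⟩) h

/-- For continuous integrands and weights, the Riemann processes converge in weighted mean
square along each path. -/
lemma tendsto_lintegral_riemannProcess {T : ℝ≥0} (hT : 0 < T) {g : ℝ≥0 → Ω → ℝ}
    (hg : ∀ t, Measurable[𝓕 t] (g t)) {ω : Ω} (hgc : Continuous fun t => g t ω)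
    {a : ℝ≥0 → ℝ} (ha : Continuous a) :
    Tendsto (fun N : ℕ => ∫⁻ t in Set.Ioc (0 : ℝ) T, ENNReal.ofReal
      (((riemannProcess T g hg N).value t.toNNReal ω - g t.toNNReal ω) ^ 2 * a t.toNNReal))
      atTop (𝓝 0) := by
  obtain ⟨B, hB⟩ := (isCompact_Icc (a := (0 : ℝ≥0)) (b := T)).exists_bound_of_continuousOn
    hgc.continuousOn
  obtain ⟨A, hA⟩ := (isCompact_Icc (a := (0 : ℝ≥0)) (b := T)).exists_bound_of_continuousOn
    ha.continuousOn
  have hB' : ∀ s ≤ T, |g s ω| ≤ B := fun s hs => hB s ⟨zero_le, hs⟩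
  have hA' : ∀ s ≤ T, |a s| ≤ A := fun s hs => hA s ⟨zero_le, hs⟩
  have hpt : ∀ t : ℝ≥0, 0 < t → t ≤ T →
      Tendsto (fun N : ℕ => (riemannProcess T g hg N).value t ω) atTop (𝓝 (g t ω)) := by
    intro t ht htT
    have : ∀ N : ℕ, ∃ s : ℝ≥0, 0 < N → s ≤ T ∧ dist s t ≤ T / N ∧
        (riemannProcess T g hg N).value t ω = max (-N : ℝ) (min (g s ω) N) := by
      intro N
      rcases Nat.eq_zero_or_pos N with rfl | hN
      · exact ⟨0, fun h => absurd h (lt_irrefl 0)⟩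
      · obtain ⟨s, h⟩ := riemannProcess_value_eq hg ω hT hN ht htT
        exact ⟨s, fun _ => h⟩
    choose s hs using this
    have hst : Tendsto s atTop (𝓝 t) := by
      rw [tendsto_iff_dist_tendsto_zero]
      refine squeeze_zero' (Eventually.of_forall fun _ => dist_nonneg) ?_
        (tendsto_const_div_atTop_nhds_zero_nat (T : ℝ))
      filter_upwards [eventually_gt_atTop 0] with N hN using (hs N hN).2.1
    refine ((hgc.tendsto t).comp hst).congr' ?_
    obtain ⟨M, hM⟩ := exists_nat_ge B
    filter_upwards [eventually_gt_atTop 0, eventually_ge_atTop M] with N hN hMN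
    have hNB : B ≤ N := hM.trans (by exact_mod_cast hMN)
    rw [(hs N hN).2.2, max_neg_min_eq_self ((hB' _ (hs N hN).1).trans hNB), Function.comp]
  have hB0 : 0 ≤ B := (abs_nonneg _).trans (hB' 0 zero_le)
  rw [show (𝓝 (0 : ℝ≥0∞)) = 𝓝 (∫⁻ _ in Set.Ioc (0 : ℝ) T, 0) by simp]
  -- Clipping does not increase absolute values, so with `|g| ≤ B` and `|a| ≤ A` on `[0, T]` the
  -- integrand is at most `(2B)² A`.
  refine tendsto_lintegral_filter_of_dominated_convergence
    (fun _ => ENNReal.ofReal ((2 * B) ^ 2 * A)) ?_ ?_ ?_ ?_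
  · refine Eventually.of_forall fun N => Measurable.ennreal_ofReal ?_
    refine Measurable.mul (Measurable.pow_const (Measurable.sub ?_ ?_) 2) ?_
    · exact (riemannProcess T g hg N).measurable_value.comp (measurable_id.prodMk measurable_const)
    · exact hgc.measurable.comp measurable_real_toNNReal
    · exact ha.measurable.comp measurable_real_toNNReal
  · filter_upwards [eventually_gt_atTop 0] with N hN
    refine (ae_restrict_iff' measurableSet_Ioc).2 (ae_of_all _ fun t ht => ?_)
    have h0 : 0 < t.toNNReal := by simpa using ht.1
    have h1 : t.toNNReal ≤ T := Real.toNNReal_le_iff_le_coe.2 ht.2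
    obtain ⟨s, hsT, -, hsv⟩ := riemannProcess_value_eq hg ω hT hN h0 h1
    refine ENNReal.ofReal_le_ofReal ((mul_le_mul_of_nonneg_left
      ((le_abs_self _).trans (hA' _ h1)) (sq_nonneg _)).trans
      (mul_le_mul_of_nonneg_right ?_ ((abs_nonneg _).trans (hA' _ h1))))
    refine sq_le_sq' ?_ ?_ <;> rw [hsv]
    all_goals
      have h2 := abs_le.1 ((abs_max_neg_min_le (x := g s ω) (Nat.cast_nonneg N)).trans (hB' s hsT))
      have h3 := abs_le.1 (hB' _ h1)
      linarith [h2.1, h2.2, h3.1, h3.2]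
  · simp [ENNReal.mul_eq_top]
  · refine (ae_restrict_iff' measurableSet_Ioc).2 (ae_of_all _ fun t ht => ?_)
    have h0 : 0 < t.toNNReal := by simpa using ht.1
    have h1 : t.toNNReal ≤ T := Real.toNNReal_le_iff_le_coe.2 ht.2
    have h2 := ((((hpt _ h0 h1).sub_const (g t.toNNReal ω)).pow 2).mul_const (a t.toNNReal))
    rw [sub_self] at h2
    have h3 := ENNReal.tendsto_ofReal h2
    simpa using h3

/-! ### Wiener integrals of deterministic functions -/

lemma eLpNorm_two_sq {α : Type*} {m : MeasurableSpace α} (μ : Measure α) (f : α → ℝ) :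
    eLpNorm f 2 μ ^ 2 = ∫⁻ x, ENNReal.ofReal (f x ^ 2) ∂μ := by
  have h := eLpNorm_nnreal_pow_eq_lintegral (f := f) (μ := μ) (p := 2) (by norm_num)
  simp only [NNReal.coe_ofNat, ENNReal.coe_ofNat, ENNReal.rpow_ofNat] at h
  rw [h]
  refine lintegral_congr fun x => ?_
  rw [← sq_abs (f x), ENNReal.ofReal_pow (abs_nonneg _), Real.enorm_eq_ofReal_abs]

lemma sqInt_eq_eLpNorm (T : ℝ≥0) (g : ℝ≥0 → ℝ) :
    sqInt T g = eLpNorm (fun t : ℝ => g t.toNNReal) 2 (volume.restrict (Set.Ioc (0 : ℝ) T)) ^ 2 :=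
  (eLpNorm_two_sq _ _).symm

lemma toNNReal_ae_eq (T : ℝ≥0) (h : ℝ → ℝ) :
    (fun t : ℝ => h (t.toNNReal : ℝ)) =ᵐ[volume.restrict (Set.Ioc (0 : ℝ) T)] h := by
  refine (ae_restrict_iff' measurableSet_Ioc).2 (ae_of_all _ fun t ht => ?_)
  dsimp only
  rw [Real.coe_toNNReal _ ht.1.le]

lemma TimeMeasurable.of_aestronglyMeasurable {T : ℝ≥0} {h : ℝ → ℝ}
    (hh : AEStronglyMeasurable h (volume.restrict (Set.Ioc (0 : ℝ) T))) :
    TimeMeasurable T fun t => h t :=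
  hh.aemeasurable.congr (toNNReal_ae_eq T h).symm

/-- A simple process whose coefficients do not depend on chance. -/
def SimpleProcess.IsDeterministic (K : SimpleProcess 𝓕) : Prop :=
  ∃ f : ℕ → ℝ, ∀ i ω, K.coef i ω = f i

namespace SimpleProcess.IsDeterministic

variable {K : SimpleProcess 𝓕}

lemma value_eq (hK : K.IsDeterministic) (t : ℝ≥0) (ω ω' : Ω) : K.value t ω = K.value t ω' := by
  obtain ⟨f, hf⟩ := hK
  simp only [SimpleProcess.value, hf]

/-- The integral of a deterministic simple process is Gaussian. -/
lemma hasLaw_integral [IsProbabilityMeasure P] (hW : IsWienerProcess 𝓕 P W)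
    (hK : K.IsDeterministic) (T : ℝ≥0) (ω₀ : Ω) :
    HasLaw (K.integral W T) (gaussianReal 0 (sqInt T fun t => K.value t ω₀).toNNReal) P := by
  obtain ⟨f, hf⟩ := hK
  set d : ℕ → ℝ≥0 := fun i => min (K.time (i + 1)) T - min (K.time i) T with hd
  have hd' : ∀ i, (d i : ℝ) = (min (K.time (i + 1)) T : ℝ≥0) - (min (K.time i) T : ℝ≥0) := fun i =>
    NNReal.coe_sub (K.min_time_le T i)
  have hv : (sqInt T fun t => K.value t ω₀).toNNReal
      = ∑ i ∈ Finset.range K.n, NNReal.mk (f i ^ 2) (sq_nonneg _) * d i := by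
    rw [sqInt_value]
    simp only [hf, ← hd']
    have : ∑ i ∈ Finset.range K.n, f i ^ 2 * (d i : ℝ)
        = ((∑ i ∈ Finset.range K.n, NNReal.mk (f i ^ 2) (sq_nonneg _) * d i : ℝ≥0) : ℝ) := by
      push_cast
      rfl
    rw [this, ENNReal.ofReal_coe_nnreal, ENNReal.toNNReal_coe]
  rw [hv]
  -- Each new increment is independent of the preceding partial sum, so variances add term by term.
  have key : ∀ n, HasLaw (K.partialIntegral W T n) (gaussianReal 0
      (∑ i ∈ Finset.range n, NNReal.mk (f i ^ 2) (sq_nonneg _) * d i)) P := by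
    intro n
    induction n with
    | zero =>
      have : K.partialIntegral W T 0 = fun _ => 0 := by ext; simp [partialIntegral]
      rw [this, Finset.range_zero, Finset.sum_empty, gaussianReal_zero_var]
      exact hasLaw_dirac_of_ae_eq (ae_of_all _ fun _ => rfl)
    | succ n ih =>
      have e : K.partialIntegral W T (n + 1) = K.partialIntegral W T n + fun ω =>
        f n * (W (min (K.time (n + 1)) T) ω - W (min (K.time n) T) ω) :=
          funext fun ω => by rw [K.partialIntegral_succ W T n ω, hf]; rfl
      rw [Finset.sum_range_succ, e]
      rcases le_total (K.time n) T with h | h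
      · have h1 := gaussianReal_const_mul (hW.hasLaw_increment (K.min_time_le T n)) (f n)
        rw [mul_zero] at h1
        have hind := (hW.indepFun_increment (K.min_time_le T n)
          (f := K.partialIntegral W T n)
          (by rw [min_eq_left h]; exact K.measurable_partialIntegral hW T n)).comp
          measurable_id (measurable_const_mul (f n))
        have h2 := gaussianReal_add_gaussianReal_of_indepFun hind ih.map_eq h1.map_eq
        rw [add_zero] at h2
        exact ⟨ih.aemeasurable.add h1.aemeasurable, h2⟩
      · have h' : T ≤ K.time (n + 1) := h.trans (K.time_mono (Nat.le_succ n))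
        have hdn : d n = 0 := by simp only [hd, min_eq_right h, min_eq_right h', tsub_self]
        rw [hdn, mul_zero, add_zero]
        refine ih.congr (ae_of_all _ fun ω => ?_)
        simp [min_eq_right h, min_eq_right h']
  exact key K.n

end SimpleProcess.IsDeterministic

lemma riemannProcess_isDeterministic (T : ℝ≥0) (g : ℝ≥0 → ℝ) (N : ℕ) :
    (riemannProcess (𝓕 := 𝓕) T (fun t _ => g t) (fun _ => measurable_const) N).IsDeterministic :=
  ⟨fun i => max (-N) (min (g (T * i / N)) N), fun _ _ => rfl⟩

lemma exists_continuous_sqInt_sub_le {T : ℝ≥0} {h : ℝ → ℝ}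
    (hh : MemLp h 2 (volume.restrict (Set.Ioc (0 : ℝ) T))) {e : ℝ≥0∞} (he : e ≠ 0) :
    ∃ g : ℝ → ℝ, Continuous g ∧ sqInt T (fun t => g t - h t) ≤ e := by
  have he' : e ^ (1 / 2 : ℝ) ≠ 0 := by
    simp [ENNReal.rpow_eq_zero_iff, he]
  obtain ⟨g, -, hg, hgc, -⟩ := hh.exists_hasCompactSupport_eLpNorm_sub_le (by simp) he'
  refine ⟨g, hgc, ?_⟩
  rw [sqInt_eq_eLpNorm, eLpNorm_congr_ae (toNNReal_ae_eq T fun t => g t - h t)]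
  rw [eLpNorm_sub_comm] at hg
  calc _ ≤ (e ^ (1 / 2 : ℝ)) ^ 2 := pow_le_pow_left₀ zero_le hg 2
    _ = e := by rw [← ENNReal.rpow_natCast, ← ENNReal.rpow_mul]; norm_num

/-- Square integrable functions are limits of deterministic simple processes. -/
lemma exists_deterministic_approx [Nonempty Ω] (𝓕 : Filtration ℝ≥0 mΩ) {T : ℝ≥0} (hT : 0 < T)
    {h : ℝ → ℝ} (hh : MemLp h 2 (volume.restrict (Set.Ioc (0 : ℝ) T))) :
    ∃ (F : ℕ → SimpleProcess 𝓕) (d : ℕ → ℝ≥0∞), (∀ n, (F n).IsDeterministic) ∧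
      Tendsto d atTop (𝓝 0) ∧ ∀ n ω, sqInt T (fun t => (F n).value t ω - h t) ≤ d n := by
  obtain ⟨ω₀⟩ := ‹Nonempty Ω›
  -- A continuous function within `n⁻¹` of `h`, then a Riemann process within `n⁻¹` of it: `2 (n⁻¹ +
  -- n⁻¹) = 4 n⁻¹`. For `n = 0` the inverse is `∞` and the bound is empty.
  have key : ∀ n : ℕ, ∃ F : SimpleProcess 𝓕, F.IsDeterministic ∧
      ∀ ω, sqInt T (fun t => F.value t ω - h t) ≤ 4 * (n : ℝ≥0∞)⁻¹ := by
    intro n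
    have hn : (n : ℝ≥0∞)⁻¹ ≠ 0 := by simp
    obtain ⟨g, hgc, hg⟩ := exists_continuous_sqInt_sub_le hh hn
    have hg' : Continuous fun t : ℝ≥0 => g t := hgc.comp NNReal.continuous_coe
    have hlim := tendsto_lintegral_riemannProcess (𝓕 := 𝓕) hT
      (g := fun t _ => g t) (fun _ => measurable_const) (ω := ω₀) hg'
      (a := fun _ => 1) continuous_const
    simp only [mul_one] at hlim
    obtain ⟨N, hN⟩ := (hlim.eventually_le_const (pos_iff_ne_zero.2 hn)).exists
    refine ⟨_, riemannProcess_isDeterministic T (fun t => g t) N, fun ω => ?_⟩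
    simp only [(riemannProcess_isDeterministic (𝓕 := 𝓕) T (fun t => g t) N).value_eq _ ω ω₀]
    have hfm : TimeMeasurable T fun t => (riemannProcess (𝓕 := 𝓕) T (fun t _ => g t)
        (fun _ => measurable_const) N).value t ω₀ - g t :=
      (SimpleProcess.timeMeasurable_value _ T ω₀).sub
        (hg'.measurable.comp measurable_real_toNNReal).aemeasurable
    refine (sqInt_add_le (g := fun t => g t - h t) hfm fun t => by ring).trans ?_
    refine (mul_le_mul_right (add_le_add hN hg) 2).trans (le_of_eq ?_)
    ring
  choose F hF hF' using key
  refine ⟨F, fun n => 4 * (n : ℝ≥0∞)⁻¹, hF, ?_, hF'⟩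
  have := ENNReal.Tendsto.const_mul (a := 4) ENNReal.tendsto_inv_nat_nhds_zero (Or.inr (by simp))
  simpa using this

/-- Existence of the Wiener integral of a square integrable function. -/
lemma exists_wienerIntegral [IsProbabilityMeasure P] (hW : IsWienerProcess 𝓕 P W) {T : ℝ≥0}
    (hT : 0 < T) {h : ℝ → ℝ} (hh : MemLp h 2 (volume.restrict (Set.Ioc (0 : ℝ) T))) :
    ∃ Y : Ω → ℝ, AEMeasurable Y P ∧ IsItoLimit 𝓕 P W T (fun t _ => h t) Y := by
  have : Nonempty Ω := nonempty_of_isProbabilityMeasure P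
  obtain ⟨F, d, -, hd, hFd⟩ := exists_deterministic_approx 𝓕 hT hh
  have hhm := TimeMeasurable.of_aestronglyMeasurable hh.aestronglyMeasurable
  have hmem := fun n => (F n).memLp_integral hW T
  -- The isometry for the difference process makes the simple integrals Cauchy in `L²(P)`.
  have hdist : ∀ n m, eLpNorm ((F n).integral W T - (F m).integral W T) 2 P ^ 2
      ≤ 2 * (d n + d m) := by
    intro n m
    obtain ⟨S, hS⟩ := (F m).exists_smul (-1)
    obtain ⟨R, hR⟩ := (F n).exists_add S
    have hRi : (F n).integral W T - (F m).integral W T = R.integral W T := by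
      funext ω
      rw [R.integral_eq_pair, hR, hS, Pi.sub_apply, SimpleProcess.integral_eq_pair,
        SimpleProcess.integral_eq_pair]
      ring
    rw [hRi, eLpNorm_two_sq, R.lintegral_integral_sq hW T]
    calc _ ≤ ∫⁻ _, 2 * (d n + d m) ∂P := by
          refine lintegral_mono fun ω => ?_
          refine (sqInt_add_le (f := fun t => (F n).value t ω - h t)
            (g := fun t => -1 * ((F m).value t ω - h t))
            (((F n).timeMeasurable_value T ω).sub hhm) fun t => ?_).trans ?_
          · rw [R.value_eq_pair, hR, hS, ← SimpleProcess.value_eq_pair,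
              ← SimpleProcess.value_eq_pair]
            ring
          · rw [sqInt_const_mul]
            gcongr
            · exact hFd n ω
            · simpa using hFd m ω
      _ = 2 * (d n + d m) := by simp
  have hcauchy : CauchySeq fun n => (hmem n).toLp := by
    rw [Lp.cauchySeq_Lp_iff_cauchySeq_eLpNorm]
    have h1 : Tendsto (fun p : ℕ × ℕ => (2 * (d p.1 + d p.2)) ^ (1 / 2 : ℝ)) atTop (𝓝 0) := by
      have h2 : Tendsto (fun p : ℕ × ℕ => 2 * (d p.1 + d p.2)) atTop (𝓝 0) := by
        rw [← prod_atTop_atTop_eq]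
        have := ENNReal.Tendsto.const_mul (a := 2)
          ((hd.comp tendsto_fst).add (hd.comp (tendsto_snd (f := atTop (α := ℕ)))))
          (Or.inr (by simp))
        simpa using this
      have h3 := h2.ennrpow_const (1 / 2 : ℝ)
      simpa using h3
    refine tendsto_of_tendsto_of_tendsto_of_le_of_le tendsto_const_nhds h1 (fun _ => zero_le)
      fun p => ?_
    have h4 := ENNReal.rpow_le_rpow (hdist p.1 p.2) (z := 1 / 2) (by norm_num)
    rw [← ENNReal.rpow_natCast, ← ENNReal.rpow_mul] at h4
    norm_num at h4
    rw [eLpNorm_congr_ae (((hmem p.1).coeFn_toLp).sub ((hmem p.2).coeFn_toLp))]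
    simpa using h4
  obtain ⟨Y, hY⟩ := cauchySeq_tendsto_of_complete hcauchy
  refine ⟨Y, (Lp.aestronglyMeasurable Y).aemeasurable, fun _ => hhm, F, ?_, ?_⟩
  · exact (TendstoZero.of_tendsto hd).of_le fun n => ae_of_all _ fun ω => hFd n ω
  · exact (tendstoInMeasure_of_tendsto_Lp hY).congr_left fun n => (hmem n).coeFn_toLp

/-- The Wiener integral of a square integrable function is Gaussian. -/
lemma IsItoLimit.hasLaw_of_deterministic [IsProbabilityMeasure P] (hW : IsWienerProcess 𝓕 P W)
    {T : ℝ≥0} (hT : 0 < T) (h : Lp ℝ 2 (volume.restrict (Set.Ioc (0 : ℝ) T))) {Y : Ω → ℝ}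
    (hY : IsItoLimit 𝓕 P W T (fun t _ => h t) Y) :
    HasLaw Y (gaussianReal 0 (‖h‖₊ ^ 2)) P := by
  obtain ⟨ω₀⟩ : Nonempty Ω := nonempty_of_isProbabilityMeasure P
  have : Nonempty Ω := ⟨ω₀⟩
  obtain ⟨F, d, hdet, hd, hFd⟩ := exists_deterministic_approx 𝓕 hT (Lp.memLp h)
  have hlim : TendstoInMeasure P (fun n => (F n).integral W T) atTop Y :=
    IsItoLimit.tendstoInMeasure hW (fun n => .of_simple (F n) T) hY
      ((TendstoZero.of_tendsto hd).of_le fun n => ae_of_all _ fun ω => hFd n ω)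
  have hdistr := hlim.tendstoInDistribution
    fun n => ((F n).measurable_integral hW T).aemeasurable
  have hYm := hdistr.aemeasurable_limit
  have hmem : ∀ n, MemLp (fun t : ℝ => (F n).value t.toNNReal ω₀) 2
      (volume.restrict (Set.Ioc (0 : ℝ) T)) := by
    intro n
    refine ⟨((F n).timeMeasurable_value T ω₀).aestronglyMeasurable, ?_⟩
    have : eLpNorm (fun t : ℝ => (F n).value t.toNNReal ω₀) 2
      (volume.restrict (Set.Ioc (0 : ℝ) T)) ^ 2 < ∞ := by
      rw [← sqInt_eq_eLpNorm T fun t => (F n).value t ω₀, sqInt_value]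
      exact ENNReal.ofReal_lt_top
    simpa using this
  have hLp : Tendsto (fun n => (hmem n).toLp) atTop (𝓝 h) := by
    rw [Lp.tendsto_Lp_iff_tendsto_eLpNorm']
    have h3 := hd.ennrpow_const (1 / 2 : ℝ)
    rw [ENNReal.zero_rpow_of_pos (by norm_num)] at h3
    refine tendsto_of_tendsto_of_tendsto_of_le_of_le tendsto_const_nhds h3 (fun _ => zero_le)
      fun n => ?_
    have h4 := ENNReal.rpow_le_rpow (hFd n ω₀) (z := 1 / 2) (by norm_num)
    rw [sqInt_eq_eLpNorm, ← ENNReal.rpow_natCast, ← ENNReal.rpow_mul] at h4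
    norm_num at h4
    refine le_trans (le_of_eq (eLpNorm_congr_ae ?_)) (by simpa using h4)
    filter_upwards [(hmem n).coeFn_toLp, toNNReal_ae_eq T h] with t ht ht'
    rw [Pi.sub_apply, ht, ← ht', Real.coe_toNNReal']
  -- The variances of the approximating Gaussian laws converge to `‖h‖²`, so their characteristic
  -- functions determine the limit law.
  have hvar : Tendsto (fun n => (sqInt T fun t => (F n).value t ω₀).toNNReal) atTop
      (𝓝 (‖h‖₊ ^ 2)) := by
    refine (hLp.nnnorm.pow 2).congr fun n => ?_
    rw [sqInt_eq_eLpNorm, ENNReal.toNNReal_pow, Lp.nnnorm_toLp]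
  refine ⟨hYm, Measure.ext_of_charFun (funext fun t => ?_)⟩
  have h1 := ProbabilityMeasure.tendsto_iff_tendsto_charFun.1 hdistr.tendsto t
  refine tendsto_nhds_unique h1 ?_
  simp only [ProbabilityMeasure.coe_mk, ((hdet _).hasLaw_integral hW T ω₀).map_eq,
    charFun_gaussianReal]
  refine Tendsto.cexp (tendsto_const_nhds.sub (Tendsto.div_const (Tendsto.mul_const _ ?_) _))
  exact (Complex.continuous_ofReal.tendsto _).comp ((NNReal.continuous_coe.tendsto _).comp hvar)

/-! ### Approximation of `h / v` with weight `v²` -/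

/-- A progressive process is jointly measurable on `[0, T]`. -/
lemma measurable_of_progressive {H : ℝ≥0 → Ω → ℝ} (hH : IsStronglyProgressive 𝓕 H) (T : ℝ≥0) :
    Measurable fun p : ℝ × Ω => H (min p.1.toNNReal T) p.2 := by
  have h := (hH T).measurable
  -- Progressivity speaks only of times up to `T`, hence the cap `min · T`.
  have hm : Measurable[_, Subtype.instMeasurableSpace.prod (𝓕 T)] fun p : ℝ × Ω =>
      ((⟨min p.1.toNNReal T, Set.mem_Iic.2 (min_le_right _ _)⟩ : Set.Iic T), p.2) := by
    refine Measurable.prodMk ?_ ?_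
    · exact ((measurable_real_toNNReal.comp measurable_fst).min measurable_const).subtype_mk
    · exact measurable_snd.mono le_rfl (𝓕.le T)
  exact h.comp hm

lemma min_toNNReal_of_mem {T : ℝ≥0} {t : ℝ} (ht : t ∈ Set.Ioc (0 : ℝ) T) :
    min t.toNNReal T = t.toNNReal :=
  min_eq_left (Real.toNNReal_le_iff_le_coe.2 ht.2)

lemma timeMeasurable_of_progressive {H : ℝ≥0 → Ω → ℝ} (hH : IsStronglyProgressive 𝓕 H)
    (T : ℝ≥0) (ω : Ω) : TimeMeasurable T fun t => H t ω := by
  refine ((measurable_of_progressive hH T).comp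
    (measurable_id.prodMk measurable_const : Measurable fun t : ℝ => (t, ω))).aemeasurable.congr ?_
  refine (ae_restrict_iff' measurableSet_Ioc).2 (ae_of_all _ fun t ht => ?_)
  simp only [Function.comp, id, min_toNNReal_of_mem ht]

/-- A stochastic integral with respect to a Wiener process is a limit of elementary integrals. -/
lemma IsStochIntegral.isItoLimit {T : ℝ≥0} {H : ℝ≥0 → Ω → ℝ} {I : Ω → ℝ}
    (h : IsStochIntegral 𝓕 P W (fun _ _ => 1) T H I) : IsItoLimit 𝓕 P W T H I := by
  refine ⟨timeMeasurable_of_progressive h.progressive T, ?_⟩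
  obtain ⟨K, hK, hI⟩ := h.approx
  simp only [mul_one] at hK
  exact ⟨K, hK, hI⟩

/-- The weight cancels the division: approximating `h / v` for `d⟨M⟩ = v² dt` is approximating `h`
by `k v` for `dt`. -/
lemma lintegral_div_sq_mul_sq {T : ℝ≥0} {v : ℝ≥0 → ℝ} (hv : ∀ t, v t ≠ 0) (k h : ℝ≥0 → ℝ) :
    ∫⁻ t in Set.Ioc (0 : ℝ) T, ENNReal.ofReal
      ((k t.toNNReal - h t.toNNReal / v t.toNNReal) ^ 2 * v t.toNNReal ^ 2)
      = sqInt T fun t => k t * v t - h t := by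
  refine lintegral_congr fun t => ?_
  rw [← mul_pow, sub_mul, div_mul_cancel₀ _ (hv _)]

lemma tendstoZero_of_ae_tendsto [IsFiniteMeasure P] {D : ℕ → Ω → ℝ≥0∞}
    (hm : ∀ n, AEMeasurable (D n) P) (h : ∀ᵐ ω ∂P, Tendsto (fun n => D n ω) atTop (𝓝 0)) :
    TendstoZero P D := by
  have hfin : ∀ n ω, min (D n ω) 1 ≠ ∞ := fun n ω =>
    ne_top_of_le_ne_top ENNReal.one_ne_top (min_le_right _ _)
  -- Truncation at 1 makes the variables finite without affecting convergence to zero.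
  have h1 : TendstoInMeasure P (fun n ω => (min (D n ω) 1).toReal) atTop fun _ => 0 := by
    refine tendstoInMeasure_of_tendsto_ae
      (fun n => ((hm n).min aemeasurable_const).ennreal_toReal.aestronglyMeasurable) ?_
    filter_upwards [h] with ω hω
    have h2 : Tendsto (fun n => min (D n ω) 1) atTop (𝓝 (min 0 1)) := hω.min tendsto_const_nhds
    rw [min_eq_left zero_le] at h2
    exact (ENNReal.tendsto_toReal ENNReal.zero_ne_top).comp h2
  intro δ hδ
  have hδ1 : min δ 1 ≠ ∞ := ne_top_of_le_ne_top ENNReal.one_ne_top (min_le_right _ _)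
  have h3 := h1 (min δ 1) (lt_min hδ one_pos)
  refine tendsto_of_tendsto_of_tendsto_of_le_of_le tendsto_const_nhds h3 (fun _ => zero_le)
    fun n => measure_mono fun ω hω => ?_
  simp only [Set.mem_ofPred_eq] at hω ⊢
  rw [edist_dist, Real.dist_eq, sub_zero, abs_of_nonneg ENNReal.toReal_nonneg,
    ENNReal.ofReal_toReal (hfin n ω)]
  exact min_le_min_right _ hω

/-- If `v` is progressive, continuous and does not vanish, then `h / v` is approximated by simple
processes in the sense of the weight `v²`. -/
lemma exists_simple_approx_div [IsProbabilityMeasure P] {T : ℝ≥0} (hT : 0 < T)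
    {v : ℝ≥0 → Ω → ℝ} (hv : IsStronglyProgressive 𝓕 v)
    (hvc : ∀ᵐ ω ∂P, Continuous fun t => v t ω) (hv0 : ∀ t ω, v t ω ≠ 0) {h : ℝ → ℝ}
    (hh : MemLp h 2 (volume.restrict (Set.Ioc (0 : ℝ) T))) :
    ∃ K : ℕ → SimpleProcess 𝓕,
      TendstoZero P fun n ω => sqInt T fun t => (K n).value t ω * v t ω - h t := by
  -- Replacing `h` by a continuous `g` makes `g / v` adapted with continuous paths, so Riemann
  -- processes converge path by path and no lower bound on `|v|` is needed.
  have key : ∀ n : ℕ, ∃ (K : SimpleProcess 𝓕) (g : ℝ → ℝ), Continuous g ∧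
      sqInt T (fun t => g t - h t) ≤ (n : ℝ≥0∞)⁻¹ ∧
      P {ω | (n : ℝ≥0∞)⁻¹ ≤ sqInt T fun t => K.value t ω * v t ω - g t} ≤ (n : ℝ≥0∞)⁻¹ := by
    intro n
    have hn : (n : ℝ≥0∞)⁻¹ ≠ 0 := by simp
    obtain ⟨g, hgc, hg⟩ := exists_continuous_sqInt_sub_le hh hn
    have hg' : Continuous fun t : ℝ≥0 => g t := hgc.comp NNReal.continuous_coe
    have hadp : ∀ t, Measurable[𝓕 t] fun ω => g t / v t ω := fun t =>
      (hv.stronglyAdapted t).measurable.const_div _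
    have hlim : TendstoZero P fun N ω => sqInt T fun t =>
        (riemannProcess T (fun t ω => g t / v t ω) hadp N).value t ω * v t ω - g t := by
      refine tendstoZero_of_ae_tendsto (fun N => ?_) ?_
      · refine Measurable.aemeasurable ?_
        have hjoint : Measurable fun p : Ω × ℝ => ENNReal.ofReal
            (((riemannProcess T (fun t ω => g t / v t ω) hadp N).value p.2.toNNReal p.1
              * v (min p.2.toNNReal T) p.1 - g p.2.toNNReal) ^ 2) := by
          refine Measurable.ennreal_ofReal (Measurable.pow_const (Measurable.sub (Measurable.mul
            ?_ ?_) ?_) 2)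
          · exact (SimpleProcess.measurable_value _).comp measurable_swap
          · exact (measurable_of_progressive hv T).comp measurable_swap
          · exact hg'.measurable.comp (measurable_real_toNNReal.comp measurable_snd)
        have := hjoint.lintegral_prod_right' (ν := volume.restrict (Set.Ioc (0 : ℝ) T))
        convert this using 2 with ω
        refine setLIntegral_congr_fun measurableSet_Ioc fun t ht => ?_
        simp only [min_toNNReal_of_mem ht]
      · filter_upwards [hvc] with ω hω
        have := tendsto_lintegral_riemannProcess hT hadp (ω := ω)
          (hg'.div hω fun t => hv0 t ω) (a := fun t => v t ω ^ 2) (hω.pow 2)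
        exact this.congr fun N => lintegral_div_sq_mul_sq (v := fun t => v t ω)
          (fun t => hv0 t ω) (fun t => (riemannProcess T _ hadp N).value t ω) fun t => g t
    obtain ⟨N, hN⟩ := ((hlim _ (pos_iff_ne_zero.2 hn)).eventually_le_const
      (pos_iff_ne_zero.2 hn)).exists
    exact ⟨_, g, hgc, hg, hN⟩
  choose K g hgc hg hK using key
  refine ⟨K, ?_⟩
  have h1 : TendstoZero P fun n ω => sqInt T fun t => (K n).value t ω * v t ω - g n t := by
    intro δ hδ
    refine tendsto_of_tendsto_of_tendsto_of_le_of_le' tendsto_const_nhds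
      ENNReal.tendsto_inv_nat_nhds_zero (Eventually.of_forall fun _ => zero_le) ?_
    filter_upwards [ENNReal.tendsto_inv_nat_nhds_zero.eventually_le_const hδ] with n hn
    exact (measure_mono fun ω hω => hn.trans hω).trans (hK n)
  refine ((h1.add (TendstoZero.of_tendsto ENNReal.tendsto_inv_nat_nhds_zero)).const_mul
    (c := 2) (by simp)).of_le fun n => ae_of_all _ fun ω => ?_
  refine (sqInt_add_le (f := fun t => (K n).value t ω * v t ω - g n t)
    (g := fun t => g n t - h t) ?_ fun t => by ring).trans ?_
  · exact (((K n).timeMeasurable_value T ω).mul (timeMeasurable_of_progressive hv T ω)).sub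
      (((hgc n).comp NNReal.continuous_coe).measurable.comp measurable_real_toNNReal).aemeasurable
  · gcongr
    exact hg n

/-! ### The Fourier coefficients as Wiener integrals -/

section Fourier

variable {S₀ σ : ℝ → ℝ} {ε x₀ : ℝ} {T : ℝ≥0} {X : ℝ≥0 → Ω → ℝ}

lemma IsDiffusion.isItoLimit (hX : IsDiffusion 𝓕 P W S₀ σ ε x₀ T X) :
    ∀ t ≤ T, IsItoLimit 𝓕 P W t (fun s ω => ε * σ (X s ω)) fun ω => innovation S₀ X t ω - x₀ :=
  fun t ht => (hX.equation t ht).isItoLimit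

/-- The Fourier coefficient of the normalized observation is the Wiener integral. -/
lemma IsFourierCoeff.ae_eq [IsProbabilityMeasure P] (hW : IsWienerProcess 𝓕 P W)
    (hX : IsDiffusion 𝓕 P W S₀ σ ε x₀ T X) (hv0 : ∀ x, ε * σ x ≠ 0) {h : ℝ → ℝ} {Y Y' : Ω → ℝ}
    (hY : IsFourierCoeff 𝓕 P S₀ σ ε T X h Y) (hY' : IsItoLimit 𝓕 P W T (fun t _ => h t) Y') :
    Y =ᵐ[P] Y' := by
  obtain ⟨K, hK, hKY⟩ := hY.approx
  have hK' : TendstoZero P fun n ω => sqInt T fun t =>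
      (K n).value t ω * (ε * σ (X t ω)) - h t :=
    TendstoZero.of_le hK fun n => ae_of_all _ fun ω => (lintegral_div_sq_mul_sq
      (v := fun t => ε * σ (X t ω)) (fun t => hv0 _) (fun t => (K n).value t ω) fun t => h t).ge
  -- The same integrals `∫ K_n dM = ∫ K_n v dW` tend to `Y` by definition and to `Y'` by continuity.
  exact tendstoInMeasure_ae_unique hKY (IsItoLimit.tendstoInMeasure hW
    (fun n => IsItoLimit.simple_mul hW hX.isItoLimit (K n)) hY' hK')

/-- Existence of the Fourier coefficients. -/
lemma exists_isFourierCoeff [IsProbabilityMeasure P] (hW : IsWienerProcess 𝓕 P W)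
    (hX : IsDiffusion 𝓕 P W S₀ σ ε x₀ T X) (hT : 0 < T) (hσ : Continuous σ)
    (hv0 : ∀ x, ε * σ x ≠ 0) (h : Lp ℝ 2 (volume.restrict (Set.Ioc (0 : ℝ) T))) :
    ∃ Y : Ω → ℝ, IsFourierCoeff 𝓕 P S₀ σ ε T X h Y := by
  have hv : IsStronglyProgressive 𝓕 fun t ω => ε * σ (X t ω) := (hX.equation T le_rfl).progressive
  obtain ⟨Y, hYm, hY⟩ := exists_wienerIntegral hW hT (Lp.memLp h)
  obtain ⟨K, hK⟩ := exists_simple_approx_div (P := P) hT hv (by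
    filter_upwards [hX.continuous] with ω hω
    exact (hσ.comp hω).const_mul ε) (fun t ω => hv0 _) (Lp.memLp h)
  -- The Wiener integral of `h` is itself the coefficient; square integrability holds because `(h /
  -- v)² v² = h²`.
  refine ⟨Y, fun t => ?_, ae_of_all _ fun ω => ?_, hYm, K, ?_, ?_⟩
  · refine Measurable.stronglyMeasurable (Measurable.div ?_ (hv t).measurable)
    exact (Lp.stronglyMeasurable h).measurable.comp
      (NNReal.continuous_coe.measurable.comp (measurable_subtype_coe.comp measurable_fst))
  · have e := lintegral_div_sq_mul_sq (T := T) (v := fun t => ε * σ (X t ω)) (fun t => hv0 _)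
      (fun _ => 0) fun t => h t
    simp only [zero_sub, zero_mul, neg_sq] at e
    rw [e, sqInt_eq_eLpNorm]
    have e2 : eLpNorm (fun t : ℝ => -(h (t.toNNReal : ℝ))) 2 (volume.restrict (Set.Ioc (0 : ℝ) T))
        = eLpNorm h 2 (volume.restrict (Set.Ioc (0 : ℝ) T)) := by
      rw [← eLpNorm_neg h]
      exact eLpNorm_congr_ae (toNNReal_ae_eq T h).neg
    rw [e2]
    exact ENNReal.pow_lt_top (Lp.memLp h).2
  · exact hK.of_le fun n => ae_of_all _ fun ω => (lintegral_div_sq_mul_sq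
      (v := fun t => ε * σ (X t ω)) (fun t => hv0 _) (fun t => (K n).value t ω) fun t => h t).le
  · exact IsItoLimit.tendstoInMeasure hW
      (fun n => IsItoLimit.simple_mul hW hX.isItoLimit (K n)) hY hK

end Fourier

/-! ### Independence and the main theorem -/

/-- Wiener integrals of an orthonormal family are independent standard Gaussian variables. -/
lemma iIndepFun_wienerIntegral [IsProbabilityMeasure P] (hW : IsWienerProcess 𝓕 P W) {T : ℝ≥0}
    (hT : 0 < T) {ι : Type*} {φ : ι → Lp ℝ 2 (volume.restrict (Set.Ioc (0 : ℝ) T))}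
    (hφ : Orthonormal ℝ φ) {y : ι → Ω → ℝ}
    (hy : ∀ j, IsItoLimit 𝓕 P W T (fun t _ => φ j t) (y j)) :
    (∀ j, HasLaw (y j) (gaussianReal 0 1) P) ∧ iIndepFun y P := by
  have hlaw : ∀ j, HasLaw (y j) (gaussianReal 0 1) P := by
    intro j
    have := IsItoLimit.hasLaw_of_deterministic hW hT (φ j) (hy j)
    have hn : ‖φ j‖₊ = 1 := NNReal.eq (hφ.1 j)
    rwa [hn, one_pow] at this
  refine ⟨hlaw, iIndepFun_iff_finset.2 fun s => ?_⟩
  rw [iIndepFun_iff_charFun_pi (X := s.restrict y) fun i => (hlaw i).aemeasurable]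
  intro t
  -- By linearity `∑ t_i y_i` is the Wiener integral of `∑ t_i φ_i`, whose squared norm is `∑ t_i²`
  -- by orthonormality.
  have hsum : IsItoLimit 𝓕 P W T (fun r _ => (∑ i : s, t i • φ i :
      Lp ℝ 2 (volume.restrict (Set.Ioc (0 : ℝ) T))) r) fun ω => ∑ i : s, t i * y i ω := by
    refine (IsItoLimit.sum (Finset.univ (α := s)) fun i _ => (hy i).const_mul (t i)).congr
      (fun ω => ?_) (ae_of_all _ fun ω => rfl)
    have h1 := Lp.coeFn_finsetSum Finset.univ fun i : s => t i • φ i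
    have h2 : ∀ᵐ r ∂volume.restrict (Set.Ioc (0 : ℝ) T), ∀ i : s, (t i • φ i) r = t i * φ i r :=
      ae_all_iff.2 fun i => Lp.coeFn_smul (t i) (φ i)
    have h3 : ∀ᵐ r : ℝ ∂volume.restrict (Set.Ioc (0 : ℝ) T), ((r.toNNReal : ℝ≥0) : ℝ) = r :=
      toNNReal_ae_eq T id
    filter_upwards [h1, h2, h3] with r hr1 hr2 hr3
    rw [hr3, hr1, Finset.sum_apply]
    exact Finset.sum_congr rfl fun i _ => (hr2 i).symm
  have hl := IsItoLimit.hasLaw_of_deterministic hW hT _ hsum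
  have hnorm : ((‖∑ i : s, t i • φ i‖₊ ^ 2 : ℝ≥0) : ℝ) = ∑ i : s, t i ^ 2 := by
    have hφs : Orthonormal ℝ fun i : s => φ i := hφ.comp _ Subtype.val_injective
    have h4 := hφs.inner_sum (fun i => t i) (fun i => t i) Finset.univ
    rw [real_inner_self_eq_norm_sq] at h4
    push_cast
    rw [h4]
    simp [sq]
  have hym : AEMeasurable (fun ω => WithLp.toLp 2 (fun i : s => s.restrict y i ω)) P := by
    have : AEMeasurable (fun ω => fun i : s => s.restrict y i ω) P :=
      aemeasurable_pi_lambda _ fun i => (hlaw i).aemeasurable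
    exact (WithLp.measurable_toLp 2 _).comp_aemeasurable this
  -- The joint characteristic function at `t` is that of `∑ t_i y_i` at 1, namely `exp (-∑ t_i² /
  -- 2)`, which factorizes.
  have hchar : charFun (P.map fun ω => WithLp.toLp 2 (fun i : s => s.restrict y i ω)) t
      = charFun (P.map fun ω => ∑ i : s, t i * y i ω) 1 := by
    rw [charFun_apply, charFun_apply, integral_map hym (by fun_prop),
      integral_map hl.aemeasurable (by fun_prop)]
    refine integral_congr_ae (ae_of_all _ fun ω => ?_)
    simp [PiLp.inner_apply]
  rw [hchar, hl.map_eq, charFun_gaussianReal, hnorm]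
  have : ∀ i : s, charFun (P.map (s.restrict y i)) (t i) = Complex.exp (-(t i ^ 2 / 2 : ℝ)) := by
    intro i
    rw [show s.restrict y i = y i from rfl, (hlaw i).map_eq, charFun_gaussianReal]
    simp
  rw [Finset.prod_congr rfl fun i _ => this i, ← Complex.exp_sum]
  congr 1
  simp [Finset.sum_div]

end ChiSquareGoF

open ChiSquareGoF in
/-- For every `ε > 0` the observation `X ε` follows, on its own filtered probability space, the
equation with trend `S₀` (the basic hypothesis); `φ` is an orthonormal basis of `L²(0, T)`. -/
theorem proposition3
    (T : ℝ≥0) (hT : 0 < T) (x₀ L : ℝ) (S₀ σ : ℝ → ℝ)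
    (hLip : ∀ x y, |S₀ x - S₀ y| + |σ x - σ y| ≤ L * |x - y|)
    (hσ : ∀ x, 0 < σ x ^ 2)
    (φ : HilbertBasis ℤ ℝ (Lp ℝ 2 (volume.restrict (Set.Ioc (0 : ℝ) T))))
    (Ω : ℝ → Type*) [mΩ : ∀ ε, MeasurableSpace (Ω ε)]
    (P : ∀ ε, Measure (Ω ε)) [∀ ε, IsProbabilityMeasure (P ε)]
    (𝓕 : ∀ ε, Filtration ℝ≥0 (mΩ ε)) (W X : ∀ ε, ℝ≥0 → Ω ε → ℝ)
    (hW : ∀ ε > 0, IsWienerProcess (𝓕 ε) (P ε) (W ε))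
    (hX : ∀ ε > 0, IsDiffusion (𝓕 ε) (P ε) (W ε) S₀ σ ε x₀ T (X ε)) :
    (∀ ε > 0, ∀ j, ∃ Y : Ω ε → ℝ, IsFourierCoeff (𝓕 ε) (P ε) S₀ σ ε T (X ε) (φ j) Y) ∧
    ∀ y : ∀ ε, ℤ → Ω ε → ℝ,
      (∀ ε > 0, ∀ j, IsFourierCoeff (𝓕 ε) (P ε) S₀ σ ε T (X ε) (φ j) (y ε j)) →
      (∀ ε > 0, (∀ j, HasLaw (y ε j) (gaussianReal 0 1) (P ε)) ∧ iIndepFun (y ε) (P ε)) ∧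
      ∀ α ∈ Set.Ioo (0 : ℝ) 1, ∀ z : ℝ, cdf (gaussianReal 0 1) z = 1 - α →
        ∀ m : ℝ → ℕ, Tendsto m (𝓝[>] 0) atTop →
          Tendsto (fun ε => ∫ ω, chiSquareTest (m ε) (y ε) z ω ∂(P ε)) (𝓝[>] 0) (𝓝 α) := by
  have hσc : Continuous σ := by
    refine (LipschitzWith.of_dist_le_mul (K := L.toNNReal) fun x y => ?_).continuous
    rw [Real.dist_eq, Real.dist_eq]
    calc |σ x - σ y| ≤ L * |x - y| := by linarith [hLip x y, abs_nonneg (S₀ x - S₀ y)]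
      _ ≤ L.toNNReal * |x - y| :=
        mul_le_mul_of_nonneg_right (Real.le_coe_toNNReal L) (abs_nonneg _)
  have hv0 : ∀ ε > 0, ∀ x, ε * σ x ≠ 0 := fun ε hε x =>
    mul_ne_zero (ne_of_gt hε) fun h => by simpa [h] using hσ x
  refine ⟨fun ε hε j =>
    exists_isFourierCoeff (hW ε hε) (hX ε hε) hT hσc (hv0 ε hε) (φ j), fun y hy => ?_⟩
  have hiid : ∀ ε > 0, (∀ j, HasLaw (y ε j) (gaussianReal 0 1) (P ε)) ∧ iIndepFun (y ε) (P ε) := by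
    intro ε hε
    refine iIndepFun_wienerIntegral (hW ε hε) hT φ.orthonormal fun j => ?_
    -- Any version of the coefficient is almost surely this Wiener integral, so it inherits the Itô
    -- limit property.
    obtain ⟨Y, -, hY⟩ := exists_wienerIntegral (hW ε hε) hT (Lp.memLp (φ j))
    exact hY.congr (fun _ => ae_of_all _ fun _ => rfl)
      ((hy ε hε j).ae_eq (hW ε hε) (hX ε hε) (hv0 ε hε) hY).symm
  exact ⟨hiid, fun α _ z hz m hm =>
    tendsto_integral_chiSquareTest (eventually_mem_nhdsWithin.mono hiid) hz hm⟩
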